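/- **Setting.** Let $K$ be a commutative $\mathbb C$-algebra of functions of $q_1,\dots,q_r$, i.e. a commutative $\mathbb C$-algebra containing $\mathbb C[q_1,\dots,q_r]$ and carrying commuting derivations $\partial/\partial q_i$ that extend the usual ones. Put $q_i=e^{t_i}$ and $\partial_i=\partial/\partial t_i=q_i\,\partial/\partial q_i$. Let $D^h$ be the ring of differential operators generated by $h\partial_1,\dots,h\partial_r$ with coefficients in $K[h]$. Let integer degrees $|q_1|,\dots,|q_r|$ be given, and give $h$ degree $2$ and each $\partial_i$ degree $0$; a function $f\in K$ is homogeneous of degree $e$ if $\sum_j|q_j|\,q_j\,\partial f/\partial q_j=e f$. Let $D^h_1,\dots,D^h_u\in D^h$ be homogeneous, and suppose that $M^h=D^h/(D^h_1,\dots,D^h_u)$ (quotient by the left ideal) is free over $K[h]$ of rank $s+1$, with a basis $[P_0],\dots,[P_s]$ in which each $P_j$ is a monomial in $h\partial_1,\dots,h\partial_r$. Define $\Omega^h=\sum_i\Omega^h_i\,dt_i$ by $[\partial_iP_j]=\sum_k(\Omega^h_i)_{kj}[P_k]$, that is, $[h\partial_iP_j]=\sum_k(h\Omega^h_i)_{kj}[P_k]$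 with $h\Omega^h_i$ a matrix over $K[h]$. For an $(s+1)\times(s+1)$ matrix $A$, the block $A_{\alpha,\beta}$ consists of the entries $A_{kj}$ for which $P_k$ has degree $\alpha$ and $P_j$ has degree $\beta$ as monomials in $h\partial_1,\dots,h\partial_r$. Assume that the matrices $h\Omega^h_1,\dots,h\Omega^h_r$ have entries in $\mathbb C[q_1,\dots,q_r][h]$. Let $U\subset\mathbb C^r$ be a connected open neighbourhood of $q=0$ and let $L$ be a holomorphic map from $\{t\in\mathbb C^r:(e^{t_1},\dots,e^{t_r})\in U\}$ to the group of loops $S^1=\{|h|=1\}\to GL_{s+1}(\mathbb C)$ with $L^{-1}dL=\Omega^h$. Suppose that $L$ has a Birkhoff factorization $L=L_-L_+$, with $L_\pm$ taking values in $GL_{s+1}(\mathbb C)$ and depending holomorphically on $t$, where $L_+$ is continuous on $|h|\le1$ and holomorphic in $|h|<1$, and $L_-$ is continuous on $1\le|h|\le\infty$ and holomorphic in $1<|h|\le\infty$ with $L_-|_{h=\infty}=I$. Suppose further that $L_+$ is a holomorphic function of $q\in U$ with $L_+|_{q=0}=I$. Write $$L_+=Q_0\,(I+hQ_1+h^2Q_2+\cdots)\qquad(q\in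 U,\ |h|<1).$$ **Proposition.** If $|q_1|,\dots,|q_r|\ge4$, then for all $q\in U$: 1. $Q_0=\exp X$ for a matrix $X$ (depending on $q$) with $X_{\alpha,\beta}=0$ for $\alpha\ge\beta-1$; 2. for every $i\ge1$, $(Q_i)_{\alpha,\beta}=0$ for $\alpha\ge\beta-i-1$. In particular there is an $N$, independent of $q$, such that $Q_i=0$ on $U$ for all $i>N$, and $L_+=Q_0(I+hQ_1+\cdots+h^NQ_N)$ is a polynomial in $h$. -/

import Mathlib

open Polynomial

/-- A commutative `ℂ`-algebra `K` of functions of the variables `q₁, …, q_r`: it contains the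
polynomials in the `q_i` and carries commuting partial derivatives `∂/∂q_i` which extend the
usual ones.  (Polynomials, rational functions, germs of holomorphic functions, …) -/
class FunctionAlgebra (r : ℕ) (K : Type*) [CommRing K] [Algebra ℂ K] where
  /-- the inclusion of the polynomial functions -/
  ofPoly : MvPolynomial (Fin r) ℂ →ₐ[ℂ] K
  ofPoly_injective : Function.Injective ofPoly
  /-- the partial derivative `∂/∂q_i` -/
  partialDeriv : Fin r → Derivation ℂ K K
  partialDeriv_ofPoly : ∀ i p,
    partialDeriv i (ofPoly p) = ofPoly (MvPolynomial.pderiv i p)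
  partialDeriv_comm : ∀ i j f,
    partialDeriv i (partialDeriv j f) = partialDeriv j (partialDeriv i f)

noncomputable section

/-- The polynomial algebra `ℂ[q₁, …, q_r]` itself. -/
instance FunctionAlgebra.mvPolynomial (r : ℕ) :
    FunctionAlgebra r (MvPolynomial (Fin r) ℂ) where
  ofPoly := AlgHom.id ℂ _
  ofPoly_injective := Function.injective_id
  partialDeriv := fun i => MvPolynomial.pderiv i
  partialDeriv_ofPoly := fun _ _ => rfl
  partialDeriv_comm := fun i j f => by
    let d (k : Fin r) : Derivation ℂ (MvPolynomial (Fin r) ℂ) (MvPolynomial (Fin r) ℂ) :=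
      MvPolynomial.pderiv k
    have h : ⁅d i, d j⁆ = 0 := by
      refine MvPolynomial.derivation_ext fun k => ?_
      rw [Derivation.commutator_apply]
      simp only [d, MvPolynomial.pderiv_X, Pi.single_apply]
      split_ifs <;> simp
    have h' := congrArg (fun d => d f) h
    simp only [Derivation.commutator_apply, Derivation.zero_apply] at h'
    exact sub_eq_zero.mp h'

namespace QDM

variable (r : ℕ) (K : Type*) [CommRing K] [Algebra ℂ K] [FunctionAlgebra r K]

/-- The function `q_i`, as an element of `K`. -/
def q (i : Fin r) : K := FunctionAlgebra.ofPoly (r := r) (MvPolynomial.X i)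

/-- `∂_i = q_i ∂/∂q_i = ∂/∂t_i` acting on `K`. -/
def tDeriv (i : Fin r) : K →ₗ[ℂ] K :=
  LinearMap.mulLeft ℂ (q r K i) ∘ₗ
    (FunctionAlgebra.partialDeriv (r := r) (K := K) i : K →ₗ[ℂ] K)

/-- The operator `h ∂_i` on `K[h]`: apply `∂_i` to all coefficients and multiply by `h`. -/
def hTDeriv (i : Fin r) : Module.End ℂ K[X] :=
  Polynomial.lsum fun n => (Polynomial.monomial (n + 1)).restrictScalars ℂ ∘ₗ tDeriv r K i

/-- The ring `D^h` of differential operators (acting on `K[h]`) generated by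
`h∂₁, …, h∂_r` with coefficients in `K[h]`. -/
def Dh : Subalgebra ℂ (Module.End ℂ K[X]) :=
  Algebra.adjoin ℂ (Set.range (LinearMap.mulLeft ℂ : K[X] → Module.End ℂ K[X]) ∪
    Set.range (hTDeriv r K))

instance : Ring (Dh r K) := Subalgebra.toRing (Dh r K)

/-- The coefficients: `K[h]` as a subring of `D^h`. -/
def coeffHom : K[X] →+* Dh r K :=
  RingHom.codRestrict (Algebra.lmul ℂ K[X] : K[X] →+* Module.End ℂ K[X]) (Dh r K)
    (fun a => Algebra.subset_adjoin (Or.inl ⟨a, rfl⟩))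

/-- The generator `h∂_i` of `D^h`. -/
def hd (i : Fin r) : Dh r K :=
  ⟨hTDeriv r K i, Algebra.subset_adjoin (Or.inr ⟨i, rfl⟩)⟩

/-- The monomial `(h∂₁)^{a₁} ⋯ (h∂_r)^{a_r}`. -/
def mono (a : Fin r → ℕ) : Dh r K := (List.ofFn fun i => hd r K i ^ a i).prod

variable {r K}

/-- With `q_j` of degree `deg j`, the function `f` is (weighted) homogeneous of degree `e`:
the Euler equation `∑ deg(q_j) q_j ∂f/∂q_j = e f`. -/
def IsHomogeneousFun (deg : Fin r → ℤ) (f : K) (e : ℤ) : Prop :=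
  ∑ j, (deg j : ℂ) • tDeriv r K j f = (e : ℂ) • f

/-- The operators which are homogeneous of degree `d`, when `h` has degree `2`, `q_j` has degree
`deg j` and `∂_j` has degree `0`: the sums of terms `f h^m (h∂)^a` with `f ∈ K` homogeneous of
degree `e` and `e + 2m + 2(a₁ + ⋯ + a_r) = d`. -/
def homogeneousOps (deg : Fin r → ℤ) (d : ℤ) : Submodule ℂ (Dh r K) :=
  Submodule.span ℂ {P | ∃ (f : K) (e : ℤ) (m : ℕ) (a : Fin r → ℕ),
    IsHomogeneousFun deg f e ∧ e + 2 * m + 2 * ((∑ i, a i : ℕ) : ℤ) = d ∧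
    P = coeffHom r K (Polynomial.monomial m f) * mono r K a}

/-- The D-module `M^h = D^h / (D₁, …, D_u)`, where `(D₁, …, D_u)` is the left ideal generated by
the `D_i`. -/
def Mh {u : ℕ} (D : Fin u → Dh r K) : Type _ :=
  Dh r K ⧸ (Submodule.span (Dh r K) (Set.range D))

namespace Mh

variable {u : ℕ} (D : Fin u → Dh r K)

instance : AddCommGroup (Mh D) :=
  inferInstanceAs (AddCommGroup (Dh r K ⧸ (Submodule.span (Dh r K) (Set.range D))))

instance : Module (Dh r K) (Mh D) :=
  inferInstanceAs (Module (Dh r K) (Dh r K ⧸ (Submodule.span (Dh r K) (Set.range D))))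

/-- `M^h` as a `K[h]`-module. -/
instance : Module K[X] (Mh D) := Module.compHom (Mh D) (coeffHom r K)

/-- The class `[P]` of an operator `P`. -/
def mk (P : Dh r K) : Mh D := Submodule.Quotient.mk P

end Mh

/-- The matrix `h Ω^h_i` of the action of `h∂_i` on `M^h` with respect to a `K[h]`-basis
`[P₀], …, [P_s]`: `[h∂_i P_j] = ∑_k (h Ω^h_i)_{kj} [P_k]`. -/
def hOmega {u s : ℕ} {D : Fin u → Dh r K}
    (b : Module.Basis (Fin (s + 1)) K[X] (Mh D)) (i : Fin r) :
    Matrix (Fin (s + 1)) (Fin (s + 1)) K[X] :=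
  Matrix.of fun k j => b.repr (hd r K i • b j) k

/-- The complex matrix `Ω^h_i(q)`, for numbers `q ∈ ℂ^r` and `h ≠ 0`, when the matrix
`W = h Ω^h_i` is polynomial in `q` and `h`. -/
def omegaAt {n : ℕ} (W : Matrix (Fin n) (Fin n) (MvPolynomial (Fin r) ℂ)[X])
    (x : Fin r → ℂ) (h : ℂ) : Matrix (Fin n) (Fin n) ℂ :=
  h⁻¹ • W.map fun p => (p.map (MvPolynomial.eval x)).eval h

/-- `q = (e^{t₁}, …, e^{t_r})`. -/
def expT (t : Fin r → ℂ) : Fin r → ℂ := fun i => Complex.exp (t i)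

/-- The region in `t`-space corresponding to the region `U` in `q`-space. -/
def tRegion (U : Set (Fin r → ℂ)) : Set (Fin r → ℂ) := {t | expT t ∈ U}

/-- `L` is a map from the region `S` in `t`-space to the loop group of `GL_n(ℂ)` (loops
parametrized by `|h| = 1`), holomorphic in `t`, with `L⁻¹ dL = ∑ Ω^h_i dt_i`,
i.e. `∂L/∂t_i = L Ω^h_i`. -/
structure IsLoopSolution {n : ℕ}
    (W : Fin r → Matrix (Fin n) (Fin n) (MvPolynomial (Fin r) ℂ)[X])
    (S : Set (Fin r → ℂ)) (L : (Fin r → ℂ) → ℂ → Matrix (Fin n) (Fin n) ℂ) : Prop where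
  continuousOn : ContinuousOn (fun p : (Fin r → ℂ) × ℂ => L p.1 p.2)
    (S ×ˢ Metric.sphere 0 1)
  isUnit : ∀ t ∈ S, ∀ h ∈ Metric.sphere (0 : ℂ) 1, IsUnit (L t h)
  differentiableOn : ∀ h ∈ Metric.sphere (0 : ℂ) 1, ∀ k j,
    DifferentiableOn ℂ (fun t => L t h k j) S
  deriv_eq : ∀ t ∈ S, ∀ h ∈ Metric.sphere (0 : ℂ) 1, ∀ i k j,
    fderiv ℂ (fun t => L t h k j) t (Pi.single i 1) = (L t h * omegaAt (W i) (expT t) h) k j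

/-- A holomorphic family, parametrized by `x ∈ S`, of maps `z ↦ F x z` from the closed unit disc
to `GL_n(ℂ)` which are holomorphic in the open disc and continuous up to the boundary. -/
structure IsDiscFamily {n : ℕ} (S : Set (Fin r → ℂ))
    (F : (Fin r → ℂ) → ℂ → Matrix (Fin n) (Fin n) ℂ) : Prop where
  continuousOn : ContinuousOn (fun p : (Fin r → ℂ) × ℂ => F p.1 p.2)
    (S ×ˢ Metric.closedBall 0 1)
  isUnit : ∀ x ∈ S, ∀ z ∈ Metric.closedBall (0 : ℂ) 1, IsUnit (F x z)
  holomorphic_param : ∀ z ∈ Metric.closedBall (0 : ℂ) 1, ∀ k j,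
    DifferentiableOn ℂ (fun x => F x z k j) S
  holomorphic_disc : ∀ x ∈ S, ∀ k j,
    DifferentiableOn ℂ (fun z => F x z k j) (Metric.ball 0 1)

/-- The Birkhoff factorization `L = L₋ L₊` over the region `U` in `q`-space, in which `L₊` is a
function of `q ∈ U`.  `L₊` extends holomorphically to `|h| < 1`, and `L₋` to `1 < |h| ≤ ∞` with
value `I` at `h = ∞`; `Lm` is `L₋` in the coordinate `z = 1/h`, so `L₋(t,h) = Lm t h⁻¹`. -/
structure IsBirkhoff {n : ℕ} (U : Set (Fin r → ℂ))
    (L Lm Lp : (Fin r → ℂ) → ℂ → Matrix (Fin n) (Fin n) ℂ) : Prop where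
  plus : IsDiscFamily U Lp
  minus : IsDiscFamily (tRegion U) Lm
  minus_infty : ∀ t ∈ tRegion U, Lm t 0 = 1
  factor : ∀ t ∈ tRegion U, ∀ h ∈ Metric.sphere (0 : ℂ) 1,
    L t h = Lm t h⁻¹ * Lp (expT t) h

/-- `L₊ = Q₀ (I + h Q₁ + h² Q₂ + ⋯)` for `|h| < 1`. -/
def IsExpansion {n : ℕ} (U : Set (Fin r → ℂ))
    (Lp : (Fin r → ℂ) → ℂ → Matrix (Fin n) (Fin n) ℂ)
    (Q : ℕ → (Fin r → ℂ) → Matrix (Fin n) (Fin n) ℂ) : Prop :=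
  ∀ x ∈ U, ∀ h ∈ Metric.ball (0 : ℂ) 1,
    HasSum (fun i : ℕ => h ^ i • (Q 0 x * if i = 0 then 1 else Q i x)) (Lp x h)

/-- The `(α, β)` block of a matrix whose rows and columns are graded by `deg`. -/
def block {n : ℕ} (deg : Fin n → ℕ) (A : Matrix (Fin n) (Fin n) ℂ) (α β : ℕ) :
    Matrix {k // deg k = α} {j // deg j = β} ℂ :=
  A.toBlock (fun k => deg k = α) (fun j => deg j = β)

end QDM

end

/-! The proof is a weight count for one ordinary differential equation. The commutator with the
Euler operator is a derivation of `D^h` preserving the left ideal, so homogeneity of the generators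
passes to the connection: a monomial `h^n q^m` can occur in the block (α, β) of `hΩ_i` only if `2n +
∑ |q_l| m_l = 2 + 2β - 2α` (`eulerOp_hOmega`, `degree_eq_of_coeff_ne_zero`). Since `|q_l| ≥ 4`, a
term with `m ≠ 0` satisfies `α + n + 1 ≤ β`, while the term free of `q` and `h` lives in `α = β +
1`.

Put `W = ∑ hΩ_i`. Differentiating `L = L₋L₊` along the Euler field `∑ ∂_i` gives `(L₊W - hL₊')L₊⁻¹ =
hL₋⁻¹L₋'` on `|h| = 1`. One side extends to the disc, the other to its exterior including infinity,
so both equal a matrix `C` independent of `h` (`exists_connection_of_birkhoff`). On each line `z ↦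
zx` this reads `h z dL₊/dz = L₊W - CL₊`.

Expanding in `h` and `z` gives a recursion, from which the coefficient of `h^m z^n`, `n ≥ 1`, is
shown to lie in blocks with `α + m + 2 ≤ β` (`formal_solution_mem_upperBlocks`). Only the commutator
of the next `h`-coefficient with the constant matrix `w 0 0` escapes an induction on `n`; it shifts
degrees by exactly one, so a second induction on `α - β` handles it.

Summing in `z` bounds the blocks of the Taylor coefficients of `L₊` at generic points near `q = 0`,
and the identity theorem spreads this over `U`. Then `Q₀ - I` is block-nilpotent, so `Q₀ = exp X`
with `X` in the same blocks, and multiplying by `exp(-X)` carries the bounds from `Q₀Q_i` to `Q_i`.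
Block degrees are bounded, so the `Q_i` eventually vanish. -/

namespace QDM

/-! ### Homogeneity of the connection matrices via the Euler operator. -/

section EulerOperator

variable {r : ℕ} {K : Type*} [CommRing K] [Algebra ℂ K] [FunctionAlgebra r K]

theorem tDeriv_apply (i : Fin r) (f : K) :
    tDeriv r K i f = q r K i * FunctionAlgebra.partialDeriv (r := r) i f := rfl

theorem tDeriv_mul (i : Fin r) (f g : K) :
    tDeriv r K i (f * g) = f * tDeriv r K i g + tDeriv r K i f * g := by
  simp only [tDeriv_apply, Derivation.leibniz, smul_eq_mul]
  ring

theorem tDeriv_comm (i j : Fin r) (f : K) :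
    tDeriv r K i (tDeriv r K j f) = tDeriv r K j (tDeriv r K i f) := by
  rcases eq_or_ne i j with rfl | hij
  · rfl
  · simp only [tDeriv_apply, q, Derivation.leibniz, smul_eq_mul,
      FunctionAlgebra.partialDeriv_ofPoly, MvPolynomial.pderiv_X, Pi.single_apply, hij, hij.symm,
      if_false, map_zero, mul_zero, add_zero, FunctionAlgebra.partialDeriv_comm i j f]
    ring

theorem tDeriv_ofPoly (i : Fin r) (p : MvPolynomial (Fin r) ℂ) :
    tDeriv r K i (FunctionAlgebra.ofPoly (r := r) p) =
      FunctionAlgebra.ofPoly (r := r) (MvPolynomial.X i * MvPolynomial.pderiv i p) := by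
  rw [tDeriv_apply, q, FunctionAlgebra.partialDeriv_ofPoly, map_mul]

variable (r K) in
/-- The Euler operator `∑ deg(q_j) q_j ∂/∂q_j` on functions. -/
noncomputable def eulerFun (deg : Fin r → ℤ) : K →ₗ[ℂ] K := ∑ j, (deg j : ℂ) • tDeriv r K j

theorem eulerFun_apply (deg : Fin r → ℤ) (f : K) :
    eulerFun r K deg f = ∑ j, (deg j : ℂ) • tDeriv r K j f := by
  simp [eulerFun]

theorem eulerFun_mul (deg : Fin r → ℤ) (f g : K) :
    eulerFun r K deg (f * g) = f * eulerFun r K deg g + eulerFun r K deg f * g := by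
  simp only [eulerFun_apply, tDeriv_mul, smul_add, Finset.sum_add_distrib, Finset.mul_sum,
    Finset.sum_mul, mul_smul_comm, smul_mul_assoc]

theorem eulerFun_tDeriv (deg : Fin r → ℤ) (i : Fin r) (f : K) :
    eulerFun r K deg (tDeriv r K i f) = tDeriv r K i (eulerFun r K deg f) := by
  simp only [eulerFun_apply, map_sum, map_smul, tDeriv_comm i]

variable (r K) in
/-- The Euler operator on `K[h]`, with `h` of degree `2`. -/
noncomputable def eulerOp (deg : Fin r → ℤ) : Module.End ℂ K[X] :=
  Polynomial.lsum fun n => (Polynomial.monomial n).restrictScalars ℂ ∘ₗ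
    (eulerFun r K deg + (2 * n : ℂ) • LinearMap.id)

theorem eulerOp_monomial (deg : Fin r → ℤ) (n : ℕ) (f : K) :
    eulerOp r K deg (monomial n f) = monomial n (eulerFun r K deg f + (2 * n : ℂ) • f) := by
  simp [eulerOp, Polynomial.lsum_apply]

theorem coeff_eulerOp (deg : Fin r → ℤ) (p : K[X]) (n : ℕ) :
    (eulerOp r K deg p).coeff n = eulerFun r K deg (p.coeff n) + (2 * n : ℂ) • p.coeff n := by
  induction p using Polynomial.induction_on' with
  | add p q hp hq => simp only [map_add, coeff_add, hp, hq, smul_add]; abel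
  | monomial m f =>
    rw [eulerOp_monomial, coeff_monomial, coeff_monomial]
    split_ifs with h
    · rw [h]
    · simp

theorem hTDeriv_monomial (i : Fin r) (n : ℕ) (f : K) :
    hTDeriv r K i (monomial n f) = monomial (n + 1) (tDeriv r K i f) := by
  simp [hTDeriv, Polynomial.lsum_apply]

theorem eulerOp_mul (deg : Fin r → ℤ) (a b : K[X]) :
    eulerOp r K deg (a * b) = a * eulerOp r K deg b + eulerOp r K deg a * b := by
  induction a using Polynomial.induction_on' with
  | add p q hp hq => simp only [add_mul, map_add, hp, hq]; abel
  | monomial m f =>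
    induction b using Polynomial.induction_on' with
    | add p q hp hq => simp only [mul_add, map_add, hp, hq]; abel
    | monomial n g =>
      simp only [monomial_mul_monomial, eulerOp_monomial, eulerFun_mul, ← map_add]
      congr 1
      simp only [Algebra.smul_def]
      push_cast
      simp only [map_ofNat]
      ring

theorem eulerOp_mulLeft (deg : Fin r → ℤ) (a : K[X]) :
    eulerOp r K deg * LinearMap.mulLeft ℂ a - LinearMap.mulLeft ℂ a * eulerOp r K deg =
      LinearMap.mulLeft ℂ (eulerOp r K deg a) := by
  ext1 b
  simp [eulerOp_mul]

/-- The weight 2 comes entirely from the factor `h`, because `∂_i` commutes with the Euler field. -/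
theorem eulerOp_hTDeriv (deg : Fin r → ℤ) (i : Fin r) :
    eulerOp r K deg * hTDeriv r K i - hTDeriv r K i * eulerOp r K deg =
      (2 : ℂ) • hTDeriv r K i := by
  ext1 p
  simp only [LinearMap.sub_apply, Module.End.mul_apply, LinearMap.smul_apply]
  induction p using Polynomial.induction_on' with
  | add p q hp hq => simp only [map_add, smul_add, ← hp, ← hq]; abel
  | monomial n f =>
    simp only [eulerOp_monomial, hTDeriv_monomial, eulerFun_tDeriv, map_add, map_smul]
    simp only [Algebra.smul_def, ← map_add, ← map_sub]
    rw [Polynomial.algebraMap_apply, Polynomial.C_mul_monomial]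
    congr 1
    push_cast
    simp only [map_ofNat]
    ring

/-- The commutator with the Euler operator preserves `D^h`. -/
theorem eulerOp_commutator_mem (deg : Fin r → ℤ) {P : Module.End ℂ K[X]} (hP : P ∈ Dh r K) :
    eulerOp r K deg * P - P * eulerOp r K deg ∈ Dh r K := by
  induction hP using Algebra.adjoin_induction with
  | mem x hx =>
    rcases hx with ⟨a, rfl⟩ | ⟨i, rfl⟩
    · rw [eulerOp_mulLeft]
      exact (coeffHom r K (eulerOp r K deg a)).2
    · rw [eulerOp_hTDeriv]
      exact Subalgebra.smul_mem _ (hd r K i).2 _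
  | algebraMap c =>
    rw [← Algebra.commutes, sub_self]
    exact zero_mem _
  | add x y _ _ hx hy =>
    have := add_mem hx hy
    rwa [show eulerOp r K deg * x - x * eulerOp r K deg +
      (eulerOp r K deg * y - y * eulerOp r K deg) =
      eulerOp r K deg * (x + y) - (x + y) * eulerOp r K deg by noncomm_ring] at this
  | mul x y hx' hy' hx hy =>
    have := add_mem (mul_mem hx hy') (mul_mem hx' hy)
    rwa [show (eulerOp r K deg * x - x * eulerOp r K deg) * y +
      x * (eulerOp r K deg * y - y * eulerOp r K deg) =
      eulerOp r K deg * (x * y) - (x * y) * eulerOp r K deg by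
      simp only [sub_mul, mul_sub, mul_assoc]; abel] at this

/-- The commutator with the Euler operator, as a map on `D^h`. -/
noncomputable def adEuler (deg : Fin r → ℤ) : Dh r K →ₗ[ℂ] Dh r K where
  toFun P := ⟨eulerOp r K deg * P.1 - P.1 * eulerOp r K deg, eulerOp_commutator_mem deg P.2⟩
  map_add' P Q := by
    apply Subtype.ext
    change _ * (P.1 + Q.1) - (P.1 + Q.1) * _ = (_ - _) + (_ - _)
    noncomm_ring
  map_smul' c P := by
    apply Subtype.ext
    change _ * (c • P.1) - (c • P.1) * _ = c • (_ - _)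
    rw [mul_smul_comm, smul_mul_assoc, smul_sub]

theorem adEuler_mul (deg : Fin r → ℤ) (P Q : Dh r K) :
    adEuler deg (P * Q) = adEuler deg P * Q + P * adEuler deg Q := by
  apply Subtype.ext
  change _ * (P.1 * Q.1) - (P.1 * Q.1) * _ = (_ - _) * Q.1 + P.1 * (_ - _)
  simp only [sub_mul, mul_sub, mul_assoc]
  abel

theorem adEuler_coeffHom (deg : Fin r → ℤ) (a : K[X]) :
    adEuler deg (coeffHom r K a) = coeffHom r K (eulerOp r K deg a) :=
  Subtype.ext (eulerOp_mulLeft deg a)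

theorem adEuler_hd (deg : Fin r → ℤ) (i : Fin r) :
    adEuler deg (hd r K i) = (2 : ℂ) • hd r K i :=
  Subtype.ext (eulerOp_hTDeriv deg i)

theorem adEuler_one (deg : Fin r → ℤ) : adEuler deg (1 : Dh r K) = 0 := by
  apply Subtype.ext
  change _ * 1 - 1 * _ = (0 : Module.End ℂ K[X])
  simp

theorem adEuler_hd_pow (deg : Fin r → ℤ) (i : Fin r) (n : ℕ) :
    adEuler deg (hd r K i ^ n) = (2 * n : ℂ) • hd r K i ^ n := by
  induction n with
  | zero => simp [adEuler_one]
  | succ n ih =>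
    rw [pow_succ, adEuler_mul, ih, adEuler_hd, smul_mul_assoc, mul_smul_comm, ← add_smul]
    push_cast
    ring_nf

theorem adEuler_list_prod (deg : Fin r → ℤ) (l : List (Dh r K × ℂ))
    (hl : ∀ x ∈ l, adEuler deg x.1 = x.2 • x.1) :
    adEuler deg (l.map Prod.fst).prod = (l.map Prod.snd).sum • (l.map Prod.fst).prod := by
  induction l with
  | nil => simp [adEuler_one]
  | cons x l ih =>
    rw [List.forall_mem_cons] at hl
    simp only [List.map_cons, List.prod_cons, List.sum_cons]
    rw [adEuler_mul, ih hl.2, hl.1, smul_mul_assoc, mul_smul_comm, add_smul]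

theorem adEuler_mono (deg : Fin r → ℤ) (a : Fin r → ℕ) :
    adEuler deg (mono r K a) = (2 * (∑ i, a i : ℕ) : ℂ) • mono r K a := by
  have := adEuler_list_prod deg (List.ofFn fun i => (hd r K i ^ a i, (2 * a i : ℂ))) (by
    intro x hx
    obtain ⟨i, rfl⟩ := (List.mem_ofFn' _ _).1 hx
    exact adEuler_hd_pow deg i (a i))
  rw [List.map_ofFn, List.map_ofFn, List.sum_ofFn] at this
  simp only [Function.comp_def] at this
  rw [mono, this]
  push_cast
  rw [Finset.mul_sum]

/-- Weights add under products because `adEuler` is a derivation. Homogeneity thus becomes an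
eigenvalue equation, which makes sense although `K` need not be a direct sum of its homogeneous
parts. -/
theorem adEuler_of_mem_homogeneousOps {deg : Fin r → ℤ} {d : ℤ} {P : Dh r K}
    (hP : P ∈ homogeneousOps deg d) : adEuler deg P = (d : ℂ) • P := by
  induction hP using Submodule.span_induction with
  | mem x hx =>
    obtain ⟨f, e, m, a, hf, hd, rfl⟩ := hx
    rw [adEuler_mul, adEuler_coeffHom, adEuler_mono, eulerOp_monomial, eulerFun_apply, hf,
      ← add_smul, mul_smul_comm, ← Polynomial.smul_monomial, ← hd]
    have : ∀ (c : ℂ) (p : K[X]), coeffHom r K (c • p) = c • coeffHom r K p := fun c p =>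
      Subtype.ext (map_smul (Algebra.lmul ℂ K[X]) c p)
    rw [this, smul_mul_assoc, ← add_smul]
    push_cast
    rfl
  | zero => simp
  | add x y _ _ hx hy => rw [map_add, hx, hy, smul_add]
  | smul c x _ hx => rw [map_smul, hx, smul_comm]

/-- The left ideal generated by homogeneous operators is stable under the commutator with the
Euler operator. -/
theorem adEuler_mem_span {u : ℕ} {D : Fin u → Dh r K} {deg : Fin r → ℤ} {d : Fin u → ℤ}
    (hD : ∀ l, D l ∈ homogeneousOps deg (d l)) {P : Dh r K}
    (hP : P ∈ Submodule.span (Dh r K) (Set.range D)) :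
    adEuler deg P ∈ Submodule.span (Dh r K) (Set.range D) := by
  have hsmul : ∀ (c : ℂ) (Q : Dh r K), Q ∈ Submodule.span (Dh r K) (Set.range D) →
      c • Q ∈ Submodule.span (Dh r K) (Set.range D) := fun c Q hQ => by
    have := Submodule.smul_mem _ (c • (1 : Dh r K)) hQ
    rwa [smul_eq_mul, smul_mul_assoc, one_mul] at this
  induction hP using Submodule.span_induction with
  | mem x hx =>
    obtain ⟨l, rfl⟩ := hx
    rw [adEuler_of_mem_homogeneousOps (hD l)]
    exact hsmul _ _ (Submodule.subset_span ⟨l, rfl⟩)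
  | zero => simp
  | add x y _ _ hx hy => rw [map_add]; exact add_mem hx hy
  | smul A x hx' hx =>
    rw [smul_eq_mul, adEuler_mul]
    exact add_mem (Submodule.smul_mem _ _ hx') (Submodule.smul_mem _ _ hx)

theorem Mh.mk_eq_zero {u : ℕ} {D : Fin u → Dh r K} {P : Dh r K} :
    Mh.mk D P = 0 ↔ P ∈ Submodule.span (Dh r K) (Set.range D) :=
  Submodule.Quotient.mk_eq_zero _

theorem Mh.mk_sum_coeffHom {u : ℕ} {D : Fin u → Dh r K} {ι : Type*} (s : Finset ι)
    (c : ι → K[X]) (P : ι → Dh r K) :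
    Mh.mk D (∑ k ∈ s, coeffHom r K (c k) * P k) = ∑ k ∈ s, c k • Mh.mk D (P k) :=
  map_sum (Submodule.mkQ (Submodule.span (Dh r K) (Set.range D))) _ _

/-- The entries of the connection matrices are homogeneous. -/
theorem eulerOp_hOmega {u s : ℕ} {D : Fin u → Dh r K} {deg : Fin r → ℤ} {d : Fin u → ℤ}
    (hD : ∀ l, D l ∈ homogeneousOps deg (d l))
    (b : Module.Basis (Fin (s + 1)) K[X] (Mh D)) (a : Fin (s + 1) → Fin r → ℕ)
    (hb : ∀ j, b j = Mh.mk D (mono r K (a j))) (i : Fin r) (k j : Fin (s + 1)) :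
    eulerOp r K deg (hOmega b i k j) =
      (2 + 2 * (∑ l, a j l : ℕ) - 2 * (∑ l, a k l : ℕ) : ℂ) • hOmega b i k j := by
  set c : Fin (s + 1) → K[X] := fun k => hOmega b i k j with hc
  have hsmul : ∀ (x : ℂ) (p : K[X]), coeffHom r K (x • p) = x • coeffHom r K p := fun x p =>
    Subtype.ext (map_smul (Algebra.lmul ℂ K[X]) x p)
  -- `R` is the relation defining column `j`. Applying `adEuler - e`, with `e` the weight of `h∂_i
  -- P_j`, kills the leading term and leaves a relation among the basis elements alone; freeness
  -- makes its coefficients vanish.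
  set R : Dh r K := hd r K i * mono r K (a j) - ∑ k, coeffHom r K (c k) * mono r K (a k) with hR
  have hRI : R ∈ Submodule.span (Dh r K) (Set.range D) := by
    rw [← Mh.mk_eq_zero]
    change Mh.mk D (hd r K i * mono r K (a j)) - Mh.mk D (∑ k, _) = 0
    rw [Mh.mk_sum_coeffHom, sub_eq_zero]
    have h1 := b.sum_repr (hd r K i • b j)
    simp only [hb] at h1
    have h2 : ∀ k, c k = b.repr (hd r K i • Mh.mk D (mono r K (a j))) k := fun k => by
      rw [← hb]; rfl
    simp only [h2]
    exact h1.symm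
  set e : ℂ := 2 + 2 * (∑ l, a j l : ℕ) with he
  have h1 : adEuler deg R - e • R =
      ∑ k, coeffHom r K ((e - 2 * (∑ l, a k l : ℕ)) • c k - eulerOp r K deg (c k)) *
        mono r K (a k) := by
    rw [hR, map_sub, adEuler_mul, adEuler_hd, adEuler_mono, map_sum, smul_sub, Finset.smul_sum,
      smul_mul_assoc, mul_smul_comm, ← add_smul, ← he, sub_sub_sub_cancel_left,
      ← Finset.sum_sub_distrib]
    refine Finset.sum_congr rfl fun k _ => ?_
    rw [adEuler_mul, adEuler_coeffHom, adEuler_mono, map_sub, hsmul, sub_smul, sub_mul, sub_mul,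
      smul_mul_assoc, smul_mul_assoc, mul_smul_comm]
    abel
  have h2 : adEuler deg R - e • R ∈ Submodule.span (Dh r K) (Set.range D) := by
    refine sub_mem (adEuler_mem_span hD hRI) ?_
    have := Submodule.smul_mem _ (e • (1 : Dh r K)) hRI
    rwa [smul_eq_mul, smul_mul_assoc, one_mul] at this
  rw [h1, ← Mh.mk_eq_zero, Mh.mk_sum_coeffHom] at h2
  simp only [← hb] at h2
  have := Fintype.linearIndependent_iff.1 b.linearIndependent _ h2 k
  exact (sub_eq_zero.1 this).symm

theorem coeff_X_mul_pderiv {σ R : Type*} [CommSemiring R] (i : σ) (p : MvPolynomial σ R)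
    (m : σ →₀ ℕ) : (MvPolynomial.X i * MvPolynomial.pderiv i p).coeff m = m i * p.coeff m := by
  classical
  induction p using MvPolynomial.induction_on' with
  | monomial d x =>
    rw [MvPolynomial.X_mul_pderiv_monomial, ← nsmul_eq_mul, MvPolynomial.coeff_smul,
      MvPolynomial.coeff_monomial]
    split_ifs with h
    · rw [h]
    · simp
  | add p q hp hq => rw [map_add, mul_add, MvPolynomial.coeff_add, hp, hq, MvPolynomial.coeff_add,
      mul_add]

/-- When `hΩ_i` is polynomial, its monomials `h^n q^m` have the expected degrees. -/
theorem degree_eq_of_coeff_ne_zero {u s : ℕ} {D : Fin u → Dh r K} {deg : Fin r → ℤ}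
    {d : Fin u → ℤ} (hD : ∀ l, D l ∈ homogeneousOps deg (d l))
    (b : Module.Basis (Fin (s + 1)) K[X] (Mh D)) (a : Fin (s + 1) → Fin r → ℕ)
    (hb : ∀ j, b j = Mh.mk D (mono r K (a j)))
    (W : Fin r → Matrix (Fin (s + 1)) (Fin (s + 1)) (Polynomial (MvPolynomial (Fin r) ℂ)))
    (hW : ∀ i, QDM.hOmega b i = (W i).map (Polynomial.map
      ((FunctionAlgebra.ofPoly (r := r) (K := K) : MvPolynomial (Fin r) ℂ →ₐ[ℂ] K) :
        MvPolynomial (Fin r) ℂ →+* K)))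
    (i : Fin r) (k j : Fin (s + 1)) (n : ℕ) (m : Fin r →₀ ℕ)
    (hne : ((W i k j).coeff n).coeff m ≠ 0) :
    2 * (n : ℤ) + ∑ l, deg l * m l = 2 + 2 * (∑ l, a j l : ℕ) - 2 * (∑ l, a k l : ℕ) := by
  have h := congrArg (fun p => p.coeff n) (eulerOp_hOmega hD b a hb i k j)
  simp only [hW i, Matrix.map_apply, coeff_eulerOp, coeff_smul, coeff_map, eulerFun_apply] at h
  simp only [RingHom.coe_coe, tDeriv_ofPoly, ← map_smul, ← map_sum, ← map_add] at h
  have h' := congrArg (MvPolynomial.coeff m) (FunctionAlgebra.ofPoly_injective h)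
  simp only [MvPolynomial.coeff_add, MvPolynomial.coeff_sum, MvPolynomial.coeff_smul,
    coeff_X_mul_pderiv, smul_eq_mul, ← mul_assoc, ← Finset.sum_mul, ← add_mul] at h'
  have h'' := mul_right_cancel₀ hne h'
  have : ((2 * (n : ℤ) + ∑ l, deg l * m l : ℤ) : ℂ) =
      ((2 + 2 * (∑ l, a j l : ℕ) - 2 * (∑ l, a k l : ℕ) : ℤ) : ℂ) := by
    push_cast
    push_cast at h''
    rw [← h'']
    ring
  exact_mod_cast this

end EulerOperator

/-! ### The filtration of matrices by block degree. -/

section GradedMatrices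

set_option linter.unusedSectionVars false

variable {ι : Type*} [Fintype ι] [DecidableEq ι] (deg : ι → ℕ)

/-- The matrices whose nonzero entries lie in blocks `(α, β)` with `α + c ≤ β`. -/
def upperBlocks (c : ℤ) : Submodule ℂ (Matrix ι ι ℂ) where
  carrier := {A | ∀ k j, (deg j : ℤ) < deg k + c → A k j = 0}
  add_mem' hA hB k j h := by simp [hA k j h, hB k j h]
  zero_mem' _ _ _ := rfl
  smul_mem' z A hA k j h := by simp [hA k j h]

variable {deg}

theorem upperBlocks_anti {c d : ℤ} (h : c ≤ d) : upperBlocks deg d ≤ upperBlocks deg c :=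
  fun _ hA k j hkj => hA k j (by omega)

theorem mul_mem_upperBlocks {c d : ℤ} {A B : Matrix ι ι ℂ} (hA : A ∈ upperBlocks deg c)
    (hB : B ∈ upperBlocks deg d) : A * B ∈ upperBlocks deg (c + d) := by
  intro k j hkj
  rw [Matrix.mul_apply]
  refine Finset.sum_eq_zero fun l _ => ?_
  rcases lt_or_ge (deg l : ℤ) (deg k + c) with h | h
  · rw [hA k l h, zero_mul]
  · rw [hB l j (by omega), mul_zero]

theorem mul_mem_upperBlocks_of_le {c d e : ℤ} {A B : Matrix ι ι ℂ}
    (hA : A ∈ upperBlocks deg c) (hB : B ∈ upperBlocks deg d) (h : e ≤ c + d) :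
    A * B ∈ upperBlocks deg e :=
  upperBlocks_anti h (mul_mem_upperBlocks hA hB)

theorem one_mem_upperBlocks : (1 : Matrix ι ι ℂ) ∈ upperBlocks deg 0 :=
  fun k j h => Matrix.one_apply_ne (by rintro rfl; omega)

theorem pow_mem_upperBlocks {c : ℤ} {A : Matrix ι ι ℂ} (hA : A ∈ upperBlocks deg c) (n : ℕ) :
    A ^ n ∈ upperBlocks deg (n * c) := by
  induction n with
  | zero => simpa using one_mem_upperBlocks
  | succ n ih =>
    rw [pow_succ]
    exact mul_mem_upperBlocks_of_le ih hA (by push_cast; linarith)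

theorem eq_zero_of_mem_upperBlocks {c : ℤ} {N : ℕ} (hN : ∀ j, deg j ≤ N) (hc : (N : ℤ) < c)
    {A : Matrix ι ι ℂ} (hA : A ∈ upperBlocks deg c) : A = 0 := by
  ext k j
  exact hA k j (by have := hN j; omega)

theorem isClosed_upperBlocks (c : ℤ) : IsClosed (upperBlocks deg c : Set (Matrix ι ι ℂ)) :=
  Submodule.closed_of_finiteDimensional _

/-- Every remaining term of the exponential series is a multiple of a power at least two of `A`, and
the filtration steps are closed subspaces. -/
theorem exp_sub_mem_upperBlocks {c : ℤ} (hc : 0 ≤ c) {A : Matrix ι ι ℂ}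
    (hA : A ∈ upperBlocks deg c) :
    NormedSpace.exp A - (1 + A) ∈ upperBlocks deg (2 * c) := by
  let _ : NormedRing (Matrix ι ι ℂ) := Matrix.linftyOpNormedRing
  let _ : NormedAlgebra ℂ (Matrix ι ι ℂ) := Matrix.linftyOpNormedAlgebra
  have h := NormedSpace.exp_series_hasSum_exp' (𝕂 := ℂ) A
  rw [← hasSum_nat_add_iff' 2] at h
  simp only [Finset.sum_range_succ, Finset.sum_range_zero, Nat.factorial, pow_zero, pow_one,
    Nat.cast_one, inv_one, one_smul, zero_add, mul_one] at h
  refine (isClosed_upperBlocks (2 * c)).mem_of_tendsto h.tendsto_sum_nat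
    (Filter.Eventually.of_forall fun n => ?_)
  refine Submodule.sum_mem _ fun i _ => Submodule.smul_mem _ _ ?_
  refine upperBlocks_anti ?_ (pow_mem_upperBlocks hA (i + 2))
  push_cast
  nlinarith

theorem exp_mem_upperBlocks {c : ℤ} (hc : 0 ≤ c) {A : Matrix ι ι ℂ}
    (hA : A ∈ upperBlocks deg c) : NormedSpace.exp A ∈ upperBlocks deg 0 := by
  have h := add_mem (upperBlocks_anti (by omega) (exp_sub_mem_upperBlocks hc hA))
    (add_mem one_mem_upperBlocks (upperBlocks_anti hc hA))
  rwa [sub_add_cancel] at h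

/-- A block-unipotent matrix has a logarithm. -/
theorem exists_exp_eq_one_add {N : ℕ} (hN : ∀ j, deg j ≤ N) {c : ℤ} (hc : 1 ≤ c)
    {A : Matrix ι ι ℂ} (hA : A ∈ upperBlocks deg c) :
    ∃ X ∈ upperBlocks deg c, NormedSpace.exp X = 1 + A ∧ ∀ Z, Commute Z A → Commute Z X := by
  -- Induction on the number of filtration steps left before every matrix is zero.
  obtain ⟨n, hn⟩ : ∃ n : ℕ, (N : ℤ) < c + n := ⟨N, by omega⟩
  induction n generalizing c A with
  | zero =>
    have := eq_zero_of_mem_upperBlocks hN (by simpa using hn) hA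
    exact ⟨0, zero_mem _, by simp [this], fun Z _ => Commute.zero_right Z⟩
  | succ n ih =>
    -- Dividing out the approximate solution `exp A` leaves `1 + B` with `B` one step deeper, since
    -- the terms linear in `A` cancel. The commutation clause lets the exponentials of `A` and of
    -- the logarithm of `1 + B` be multiplied.
    set B := NormedSpace.exp (-A) * (1 + A) - 1 with hB
    have hR := exp_sub_mem_upperBlocks (by omega) (neg_mem hA)
    set R := NormedSpace.exp (-A) - (1 + -A) with hRdef
    have hBR : B = R + R * A - A * A := by
      rw [hB, show NormedSpace.exp (-A) = R + (1 + -A) by rw [hRdef]; abel]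
      noncomm_ring
    have hBmem : B ∈ upperBlocks deg (c + 1) := by
      rw [hBR]
      exact sub_mem (add_mem (upperBlocks_anti (by omega) hR)
        (mul_mem_upperBlocks_of_le hR hA (by omega))) (mul_mem_upperBlocks_of_le hA hA (by omega))
    obtain ⟨Y, hY, hYexp, hYcomm⟩ := ih (by omega) hBmem (by push_cast at hn; omega)
    have hcomm : ∀ Z, Commute Z A → Commute Z Y := fun Z hZ => hYcomm Z
      ((((hZ.neg_right).exp_right).mul_right ((Commute.one_right Z).add_right hZ)).sub_right
        (Commute.one_right Z))
    refine ⟨A + Y, add_mem hA (upperBlocks_anti (by omega) hY), ?_, fun Z hZ =>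
      hZ.add_right (hcomm Z hZ)⟩
    rw [Matrix.exp_add_of_commute _ _ (hcomm A (Commute.refl A)), hYexp, hB, add_sub_cancel,
      ← mul_assoc, ← Matrix.exp_add_of_commute _ _ ((Commute.refl A).neg_right), add_neg_cancel,
      NormedSpace.exp_zero, one_mul]

end GradedMatrices

/-! ### Block degrees in the formal recursion. -/

section FormalSolution

open Finset Finset.HasAntidiagonal

variable {ι : Type*} [Fintype ι] [DecidableEq ι] {deg : ι → ℕ}

/-- Used to isolate the one term of a convolution that the induction hypothesis does not control. -/
theorem sum_sub_mem_of_forall_ne {R V κ : Type*} [Semiring R] [AddCommGroup V] [Module R V]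
    [DecidableEq κ] (S : Submodule R V) {s : Finset κ} {x : κ} (hx : x ∈ s) {f : κ → V} {v : V}
    (h : ∀ y ∈ s, y ≠ x → f y ∈ S) (hv : f x - v ∈ S) : ∑ y ∈ s, f y - v ∈ S := by
  rw [← Finset.add_sum_erase s f hx, add_sub_right_comm]
  exact add_mem hv (Submodule.sum_mem _ fun y hy =>
    h y (Finset.mem_of_mem_erase hy) (Finset.ne_of_mem_erase hy))

/-- The coefficients `M m n` of `h^m z^n` in a formal solution of
`h z M' = M W - C M`, `M = 1` at `z = 0`, lie in the expected blocks. -/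
theorem formal_solution_mem_upperBlocks {B : ℕ} (hBd : ∀ j, deg j ≤ B)
    {M w : ℕ → ℕ → Matrix ι ι ℂ} {C : ℕ → Matrix ι ι ℂ}
    (hM0 : M 0 0 = 1) (hMs : ∀ m, M (m + 1) 0 = 0)
    (hrec0 : ∀ n : ℕ, ∑ x ∈ antidiagonal n, M 0 x.1 * w 0 x.2 =
      ∑ x ∈ antidiagonal n, C x.1 * M 0 x.2)
    (hrec : ∀ m n : ℕ, (n : ℂ) • M m n =
      ∑ y ∈ antidiagonal (m + 1), ∑ x ∈ antidiagonal n, M y.1 x.1 * w y.2 x.2 -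
        ∑ x ∈ antidiagonal n, C x.1 * M (m + 1) x.2)
    (hw : ∀ m n : ℕ, w m (n + 1) ∈ upperBlocks deg (m + 1))
    (hw0 : ∀ k j, w 0 0 k j ≠ 0 → deg k = deg j + 1)
    (n : ℕ) (hn : 1 ≤ n) (m : ℕ) : M m n ∈ upperBlocks deg (m + 2) := by
  have hC0 : C 0 = w 0 0 := by simpa [hM0] using (hrec0 0).symm
  -- At `z = 0` the normalization `M = 1` leaves only `w (m + 1) 0` in the recursion: the connection
  -- at the origin has no positive powers of `h`.
  have hws : ∀ m, w (m + 1) 0 = 0 := fun m => by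
    have h := hrec m 0
    rw [Finset.sum_eq_single_of_mem (0, m + 1) (by simp)] at h
    · simpa [hM0, hMs] using h.symm
    · rintro ⟨a, b⟩ hab hne
      obtain ⟨a, rfl⟩ : ∃ a', a = a' + 1 := Nat.exists_eq_succ_of_ne_zero (by
        rintro rfl
        simp_all)
      simp [hMs]
  have hw00 : w 0 0 ∈ upperBlocks deg (-1) := fun k j h => by
    by_contra hne
    have := hw0 k j hne
    omega
  have hw' : ∀ m n : ℕ, 1 ≤ n → w m n ∈ upperBlocks deg (m + 1) := fun m n hn => by
    obtain ⟨n, rfl⟩ := Nat.exists_eq_succ_of_ne_zero (Nat.one_le_iff_ne_zero.1 hn)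
    exact hw m n
  induction n using Nat.strong_induction_on generalizing m with
  | _ n ih =>
  -- The equation in `h`-degree zero contains no derivative and can be solved for `C p`; only `M 0
  -- x` with `x < n` enters. Products with `w 0 0` lose one step, from 2 to 1.
  have hC : ∀ p, 1 ≤ p → p < n → C p ∈ upperBlocks deg 1 := by
    intro p
    induction p using Nat.strong_induction_on with
    | _ p ihp =>
    intro hp hpn
    have h1 : ∑ x ∈ antidiagonal p, M 0 x.1 * w 0 x.2 ∈ upperBlocks deg 1 := by
      refine Submodule.sum_mem _ fun x hx => ?_
      have hx' := mem_antidiagonal.1 hx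
      rcases Nat.eq_zero_or_pos x.1 with h0 | h0
      · rw [h0, hM0, one_mul]
        exact upperBlocks_anti (by norm_num) (hw' 0 x.2 (by omega))
      · rcases Nat.eq_zero_or_pos x.2 with h2 | h2
        · rw [h2]
          exact mul_mem_upperBlocks_of_le (ih x.1 (by omega) h0 0) hw00 (by norm_num)
        · exact mul_mem_upperBlocks_of_le (ih x.1 (by omega) h0 0) (hw' 0 x.2 h2) (by norm_num)
    rw [hrec0] at h1
    have h2 : ∑ x ∈ antidiagonal p, C x.1 * M 0 x.2 - C p ∈ upperBlocks deg 1 := by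
      refine sum_sub_mem_of_forall_ne _ (x := (p, 0)) (by simp) (fun x hx hne => ?_)
        (by simp [hM0])
      have hx' := mem_antidiagonal.1 hx
      have hx2 : 1 ≤ x.2 := Nat.one_le_iff_ne_zero.2 fun h => hne (Prod.ext (by simp; omega) h)
      rcases Nat.eq_zero_or_pos x.1 with h0 | h0
      · rw [h0, hC0]
        exact mul_mem_upperBlocks_of_le hw00 (ih x.2 (by omega) hx2 0) (by norm_num)
      · exact mul_mem_upperBlocks_of_le (ihp x.1 (by omega) h0 (by omega))
          (ih x.2 (by omega) hx2 0) (by norm_num)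
    simpa using sub_mem h1 h2
  -- Modulo terms already controlled, `M m n` is determined by the commutator of the still unknown
  -- `M (m + 1) n` with `w 0 0`.
  have key : ∀ m : ℕ, (n : ℂ) • M m n - (M (m + 1) n * w 0 0 - w 0 0 * M (m + 1) n) ∈
      upperBlocks deg (m + 2) := by
    intro m
    have h1 : ∑ y ∈ antidiagonal (m + 1), ∑ x ∈ antidiagonal n,
        M y.1 x.1 * w y.2 x.2 - M (m + 1) n * w 0 0 ∈ upperBlocks deg (m + 2) := by
      have hterm : ∀ a b p q : ℕ, a + b = m + 1 → p + q = n → (a, p) ≠ (m + 1, n) →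
          M a p * w b q ∈ upperBlocks deg (m + 2) := by
        intro a b p q hab hpq hne
        rcases Nat.eq_zero_or_pos p with rfl | hp
        · rcases a with _ | a
          · rw [hM0, one_mul]
            exact upperBlocks_anti (by push_cast [show b = m + 1 by omega]; omega)
              (hw' b q (by omega))
          · rw [hMs, zero_mul]
            exact zero_mem _
        · rcases Nat.eq_zero_or_pos q with rfl | hq
          · rcases b with _ | b
            · exact absurd (Prod.ext (by simp; omega) (by simp; omega)) hne
            · rw [hws, mul_zero]
              exact zero_mem _
          · exact mul_mem_upperBlocks_of_le (ih p (by omega) hp a) (hw' b q hq) (by omega)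
      refine sum_sub_mem_of_forall_ne _ (x := (m + 1, 0)) (by simp) (fun y hy hne => ?_) ?_
      · have hy' := mem_antidiagonal.1 hy
        refine Submodule.sum_mem _ fun x hx => hterm _ _ _ _ hy' (mem_antidiagonal.1 hx) ?_
        intro h
        have := (Prod.ext_iff.1 h).1
        exact hne (Prod.ext this (by simp at this ⊢; omega))
      · refine sum_sub_mem_of_forall_ne _ (x := (n, 0)) (by simp) (fun x hx hne => ?_) (by simp)
        have hx' := mem_antidiagonal.1 hx
        refine hterm _ _ _ _ (by simp) hx' ?_
        intro h
        have := (Prod.ext_iff.1 h).2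
        exact hne (Prod.ext this (by simp at this ⊢; omega))
    have h2 : ∑ x ∈ antidiagonal n, C x.1 * M (m + 1) x.2 - w 0 0 * M (m + 1) n ∈
        upperBlocks deg (m + 2) := by
      refine sum_sub_mem_of_forall_ne _ (x := (0, n)) (by simp) (fun x hx hne => ?_)
        (by simp [hC0])
      have hx' := mem_antidiagonal.1 hx
      have hx1 : 1 ≤ x.1 := Nat.one_le_iff_ne_zero.2 fun h => hne (Prod.ext h (by simp; omega))
      rcases Nat.eq_zero_or_pos x.2 with h0 | h0
      · rw [h0, hMs, mul_zero]
        exact zero_mem _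
      · exact mul_mem_upperBlocks_of_le (hC x.1 hx1 (by omega)) (ih x.2 (by omega) h0 (m + 1))
          (by push_cast; omega)
    rw [hrec]
    convert sub_mem h1 h2 using 1
    abel
  -- Both halves of the commutator involve entries of `M (m + 1) n` whose `deg k - deg j` is one
  -- smaller, while `deg k - deg j + m` is unchanged. The forbidden region is thus preserved, and
  -- the descent ends below `-B`, where there are no entries.
  have main : ∀ t : ℕ, ∀ (m : ℕ) (k j : ι), (deg j : ℤ) < deg k + (m + 2) → (deg k : ℤ) - deg j < t - B →
      M m n k j = 0 := by
    intro t
    induction t with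
    | zero =>
      intro m k j _ h
      have := hBd j
      push_cast at h
      omega
    | succ t iht =>
      intro m k j h1 h2
      have h := key m k j h1
      have e1 : (M (m + 1) n * w 0 0) k j = 0 := by
        rw [Matrix.mul_apply]
        refine Finset.sum_eq_zero fun l _ => ?_
        by_cases hl : w 0 0 l j = 0
        · rw [hl, mul_zero]
        · have := hw0 l j hl
          push_cast at h2
          rw [iht (m + 1) k l (by push_cast; omega) (by omega), zero_mul]
      have e2 : (w 0 0 * M (m + 1) n) k j = 0 := by
        rw [Matrix.mul_apply]
        refine Finset.sum_eq_zero fun l _ => ?_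
        by_cases hl : w 0 0 k l = 0
        · rw [hl, zero_mul]
        · have := hw0 k l hl
          push_cast at h2
          rw [iht (m + 1) l j (by push_cast; omega) (by omega), mul_zero]
      simp only [Matrix.sub_apply, Matrix.smul_apply, e1, e2, sub_zero, smul_eq_mul] at h
      exact (mul_eq_zero.1 h).resolve_left (Nat.cast_ne_zero.2 (by omega))
  intro k j hkj
  refine main (2 * B + 1) m k j hkj ?_
  have := hBd k
  push_cast
  omega

end FormalSolution

/-! ### Taylor coefficients, Cauchy's formula and holomorphic parameters. -/

section Analysis

open Metric Filter Topology
open scoped Nat Real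

variable {E : Type*} [NormedAddCommGroup E] [NormedSpace ℂ E]

/-- The Taylor coefficients at `0`. -/
noncomputable def taylorCoeff (f : ℂ → E) (n : ℕ) : E := (n ! : ℂ)⁻¹ • iteratedDeriv n f 0

theorem taylorCoeff_zero (f : ℂ → E) : taylorCoeff f 0 = f 0 := by simp [taylorCoeff]

theorem taylorCoeff_congr {f g : ℂ → E} (h : f =ᶠ[𝓝 0] g) (n : ℕ) :
    taylorCoeff f n = taylorCoeff g n := by
  rw [taylorCoeff, taylorCoeff, h.iteratedDeriv_eq]

theorem taylorCoeff_sub {f g : ℂ → E} (hf : ContDiffAt ℂ ⊤ f 0) (hg : ContDiffAt ℂ ⊤ g 0)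
    (n : ℕ) : taylorCoeff (fun z => f z - g z) n = taylorCoeff f n - taylorCoeff g n := by
  simp only [taylorCoeff]
  rw [iteratedDeriv_fun_sub (hf.of_le le_top) (hg.of_le le_top), smul_sub]

theorem taylorCoeff_deriv (f : ℂ → E) (n : ℕ) :
    taylorCoeff (deriv f) n = ((n + 1 : ℕ) : ℂ) • taylorCoeff f (n + 1) := by
  simp only [taylorCoeff]
  rw [iteratedDeriv_succ', smul_smul, Nat.factorial_succ, Nat.cast_mul, mul_inv, ← mul_assoc,
    mul_inv_cancel₀ (Nat.cast_ne_zero.2 n.succ_ne_zero), one_mul]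

theorem hasSum_taylorCoeff [CompleteSpace E] {f : ℂ → E} {R : ℝ}
    (hf : DifferentiableOn ℂ f (ball 0 R)) {z : ℂ} (hz : z ∈ ball 0 R) :
    HasSum (fun n => z ^ n • taylorCoeff f n) (f z) := by
  convert Complex.hasSum_taylorSeries_on_ball hf hz using 2 with n
  rw [sub_zero, taylorCoeff, smul_comm]

theorem taylorCoeff_eq_of_hasSum [CompleteSpace E] {f : ℂ → E} {c : ℕ → E} {R : ℝ} (hR : 0 < R)
    (h : ∀ z ∈ ball 0 R, HasSum (fun n => z ^ n • c n) (f z)) (n : ℕ) :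
    taylorCoeff f n = c n := by
  set p : FormalMultilinearSeries ℂ ℂ E := fun n => ContinuousMultilinearMap.mkPiRing ℂ (Fin n) (c n)
  -- Halving the radius gives a point inside the disc where the terms tend to zero, which bounds the
  -- radius of convergence from below.
  have hp : HasFPowerSeriesOnBall f p 0 (ENNReal.ofReal (R / 2)) := by
    refine ⟨?_, by simpa using hR, fun {y} hy => ?_⟩
    · have h2 : ((R / 2 : ℝ) : ℂ) ∈ ball (0 : ℂ) R := by
        rw [mem_ball_zero_iff, Complex.norm_real, Real.norm_of_nonneg (by positivity)]
        linarith
      have h3 := (h _ h2).summable.tendsto_atTop_zero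
      refine p.le_radius_of_tendsto (l := 0) ?_
      have h4 := h3.norm
      simp only [norm_zero] at h4
      refine h4.congr fun n => ?_
      rw [norm_smul, norm_pow, Complex.norm_real, Real.norm_of_nonneg (by positivity),
        Real.coe_toNNReal _ (by positivity), ContinuousMultilinearMap.norm_mkPiRing, mul_comm]
    · have hy' : y ∈ ball (0 : ℂ) R := by
        rw [mem_eball_zero_iff, ← ofReal_norm, ENNReal.ofReal_lt_ofReal_iff (by positivity)] at hy
        rw [mem_ball_zero_iff]
        linarith
      simpa [p] using h y hy'
  have := hp.factorial_smul (1 : ℂ) n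
  rw [taylorCoeff, iteratedDeriv_eq_iteratedFDeriv, ← this]
  simp only [p, ContinuousMultilinearMap.mkPiRing_apply, Finset.prod_const_one, one_smul]
  rw [← Nat.cast_smul_eq_nsmul ℂ, smul_smul,
    inv_mul_cancel₀ (Nat.cast_ne_zero.2 n.factorial_ne_zero), one_smul]

theorem taylorCoeff_id_smul_succ [CompleteSpace E] {f : ℂ → E} {R : ℝ} (hR : 0 < R)
    (hf : DifferentiableOn ℂ f (ball 0 R)) (n : ℕ) :
    taylorCoeff (fun z => z • f z) (n + 1) = taylorCoeff f n := by
  refine taylorCoeff_eq_of_hasSum (f := fun z => z • f z)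
    (c := fun n => Nat.casesOn (motive := fun _ => E) n 0 fun n => taylorCoeff f n) hR
    (fun z hz => ?_) (n + 1)
  have h := (hasSum_taylorCoeff hf hz).const_smul z
  rw [← hasSum_nat_add_iff' 1]
  simpa [pow_succ', mul_smul] using h

theorem taylorCoeff_mul {A : Type*} [NormedRing A] [NormedAlgebra ℂ A] {f g : ℂ → A}
    (hf : ContDiffAt ℂ ⊤ f 0) (hg : ContDiffAt ℂ ⊤ g 0) (n : ℕ) :
    taylorCoeff (fun z => f z * g z) n =
      ∑ x ∈ Finset.HasAntidiagonal.antidiagonal n, taylorCoeff f x.1 * taylorCoeff g x.2 := by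
  rw [Finset.Nat.sum_antidiagonal_eq_sum_range_succ (fun i j => taylorCoeff f i * taylorCoeff g j),
    taylorCoeff, iteratedDeriv_fun_mul (hf.of_le le_top) (hg.of_le le_top), Finset.smul_sum]
  refine Finset.sum_congr rfl fun i hi => ?_
  have hi' : i ≤ n := Nat.lt_succ_iff.1 (Finset.mem_range.1 hi)
  rw [taylorCoeff, taylorCoeff, smul_mul_smul_comm, ← nsmul_eq_mul, smul_mul_assoc,
    ← Nat.cast_smul_eq_nsmul ℂ, smul_smul, Nat.cast_choose ℂ hi']
  congr 1
  have h1 : (n ! : ℂ) ≠ 0 := Nat.cast_ne_zero.2 n.factorial_ne_zero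
  field_simp

theorem contDiffAt_of_differentiableOn_ball [CompleteSpace E] {f : ℂ → E} {R : ℝ} (hR : 0 < R)
    (hf : DifferentiableOn ℂ f (ball 0 R)) : ContDiffAt ℂ ⊤ f 0 :=
  (hf.analyticAt (ball_mem_nhds _ hR)).contDiffAt

/-- A holomorphic function on a disc whose Taylor coefficients lie in a closed subspace takes
values in that subspace. -/
theorem mem_of_forall_taylorCoeff_mem [CompleteSpace E] {S : Submodule ℂ E}
    (hS : IsClosed (S : Set E)) {f : ℂ → E} {R : ℝ} (hf : DifferentiableOn ℂ f (ball 0 R))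
    (h : ∀ n, taylorCoeff f n ∈ S) {z : ℂ} (hz : z ∈ ball 0 R) : f z ∈ S :=
  hS.mem_of_tendsto (hasSum_taylorCoeff hf hz).tendsto_sum_nat
    (Eventually.of_forall fun _ => Submodule.sum_mem _ fun n _ => Submodule.smul_mem _ _ (h n))

/-- Inversion of the unit circle is the substitution `θ ↦ 2π - θ`. -/
theorem circleIntegral_comp_inv (f : ℂ → E) :
    (∮ z in C(0, 1), f z) = ∮ z in C(0, 1), (z ^ 2)⁻¹ • f z⁻¹ := by
  have hinv : ∀ θ : ℝ, circleMap 0 1 (2 * π - θ) = (circleMap 0 1 θ)⁻¹ := fun θ => by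
    rw [circleMap_zero, circleMap_zero, mul_inv, ← Complex.exp_neg]
    push_cast
    rw [sub_mul, Complex.exp_sub, Complex.exp_two_pi_mul_I, Complex.exp_neg]
    simp
  simp only [circleIntegral, deriv_circleMap]
  have h := intervalIntegral.integral_comp_sub_left (a := 0) (b := 2 * π)
    (fun θ => (circleMap 0 1 θ * Complex.I) • f (circleMap 0 1 θ)) (2 * π)
  rw [sub_self, sub_zero] at h
  rw [← h]
  simp only [hinv, smul_smul]
  refine intervalIntegral.integral_congr fun θ _ => ?_
  have := circleMap_ne_center (c := 0) one_ne_zero (θ := θ)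
  congr 1
  field_simp

/-- A function holomorphic in the unit disc which extends holomorphically to the exterior of the
disc, including infinity, is constant. -/
theorem eq_of_eq_comp_inv_on_sphere [CompleteSpace E] {f g : ℂ → E}
    (hf : DiffContOnCl ℂ f (ball 0 1)) (hg : DiffContOnCl ℂ g (ball 0 1))
    (h : ∀ z ∈ sphere (0 : ℂ) 1, f z = g z⁻¹) {w : ℂ} (hw : w ∈ ball (0 : ℂ) 1) : f w = g 0 := by
  have hne : ∀ z ∈ closedBall (0 : ℂ) 1, 1 - w * z ≠ 0 := fun z hz h0 => by
    have h1 : ‖w * z‖ = 1 := by rw [← sub_eq_zero.1 h0, norm_one]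
    rw [norm_mul] at h1
    rw [mem_ball_zero_iff] at hw
    rw [mem_closedBall_zero_iff] at hz
    nlinarith [norm_nonneg z, norm_nonneg w]
  have hd : Differentiable ℂ fun z : ℂ => 1 - w * z := by fun_prop
  have hinv : DiffContOnCl ℂ (fun z => (1 - w * z)⁻¹) (ball 0 1) := by
    refine DiffContOnCl.mk_ball (fun z hz => ?_) fun z hz => ?_
    · exact (hd.differentiableAt.inv (hne z (ball_subset_closedBall hz))).differentiableWithinAt
    · exact (hd.continuous.continuousAt.inv₀ (hne z hz)).continuousWithinAt
  -- Under `z ↦ z⁻¹`, Cauchy's formula for `f` at `w` turns into Cauchy's formula at `0` for `(1 - w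
  -- z)⁻¹ • g z`, whose value there is `g 0`.
  have h1 := hf.circleIntegral_sub_inv_smul hw
  have h2 := (hinv.smul hg).circleIntegral_sub_inv_smul (mem_ball_self one_pos)
  rw [circleIntegral_comp_inv] at h1
  have h3 : (∮ z in C(0, 1), (z ^ 2)⁻¹ • (z⁻¹ - w)⁻¹ • f z⁻¹) =
      ∮ z in C(0, 1), (z - 0)⁻¹ • ((1 - w * z)⁻¹ • g z) := by
    refine circleIntegral.integral_congr zero_le_one fun z hz => ?_
    have hz0 : z ≠ 0 := ne_of_mem_sphere hz one_ne_zero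
    have hz' : z⁻¹ ∈ sphere (0 : ℂ) 1 := by simpa using hz
    have hz1 := hne z (sphere_subset_closedBall hz)
    have hz2 : z⁻¹ - w ≠ 0 := fun h => hz1 (by
      rw [← sub_eq_zero.1 h, inv_mul_cancel₀ hz0, sub_self])
    rw [h _ hz', inv_inv, smul_smul, smul_smul]
    congr 1
    rw [sub_zero, ← mul_inv, ← mul_inv]
    congr 1
    field_simp
  rw [h3] at h1
  have h4 := h1.symm.trans h2
  rw [smul_right_inj (by simp [Real.pi_ne_zero, Complex.I_ne_zero])] at h4
  simpa using h4

variable [CompleteSpace E] {F : ℂ → ℂ → E} {ρ M : ℝ}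

/-- Difference quotients of a bounded holomorphic family converge uniformly. -/
theorem tendstoUniformlyOn_dslope (hρ : 0 < ρ)
    (hbd : ∀ τ ∈ ball (0 : ℂ) ρ, ∀ h ∈ closedBall (0 : ℂ) 1, ‖F τ h‖ ≤ M)
    (hτ : ∀ h ∈ closedBall (0 : ℂ) 1, DifferentiableOn ℂ (fun τ => F τ h) (ball 0 ρ)) :
    TendstoUniformlyOn (fun τ h => dslope (fun τ => F τ h) 0 τ)
      (fun h => deriv (fun τ => F τ h) 0) (𝓝[≠] 0) (closedBall 0 1) := by
  have h0 : (0 : ℂ) ∈ ball (0 : ℂ) ρ := mem_ball_self hρ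
  -- The Schwarz lemma is applied twice: it bounds the difference quotient by `2 * M / ρ`, then
  -- bounds the variation of this quotient, uniformly in `h`.
  have key : ∀ h ∈ closedBall (0 : ℂ) 1, ∀ τ ∈ ball (0 : ℂ) ρ,
      dist (deriv (fun τ => F τ h) 0) (dslope (fun τ => F τ h) 0 τ) ≤
        (2 * (2 * M / ρ)) / ρ * dist τ 0 := by
    intro h hh τ hτρ
    have h1 : ∀ τ ∈ ball (0 : ℂ) ρ, ‖dslope (fun τ => F τ h) 0 τ‖ ≤ 2 * M / ρ := fun τ hτ' =>
      Complex.norm_dslope_le_div_of_mapsTo_ball (hτ h hh) (fun τ hτ => by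
        rw [mem_closedBall, dist_eq_norm]
        refine (norm_sub_le _ _).trans ?_
        linarith [hbd τ hτ h hh, hbd 0 h0 h hh]) hτ'
    rw [← dslope_same, dist_comm]
    refine Complex.dist_le_div_mul_dist_of_mapsTo_ball
      ((Complex.differentiableOn_dslope (ball_mem_nhds _ hρ)).2 (hτ h hh)) (fun τ hτ => ?_) hτρ
    rw [mem_closedBall, dist_eq_norm]
    refine (norm_sub_le _ _).trans ?_
    linarith [h1 τ hτ, h1 0 h0]
  rw [Metric.tendstoUniformlyOn_iff]
  intro ε hε
  have hlim : Tendsto (fun τ : ℂ => (2 * (2 * M / ρ)) / ρ * dist τ 0) (𝓝[≠] 0) (𝓝 0) := by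
    have : Continuous fun τ : ℂ => (2 * (2 * M / ρ)) / ρ * dist τ 0 := by fun_prop
    simpa using (this.tendsto 0).mono_left nhdsWithin_le_nhds
  filter_upwards [hlim.eventually_lt_const hε,
    mem_nhdsWithin_of_mem_nhds (ball_mem_nhds (0 : ℂ) hρ)] with τ h1 h2 h hh
  exact (key h hh τ h2).trans_lt h1

omit [CompleteSpace E] in
theorem diffContOnCl_dslope
    (hh : ∀ τ ∈ ball (0 : ℂ) ρ, DiffContOnCl ℂ (F τ) (ball 0 1)) (hρ : 0 < ρ) {τ : ℂ}
    (hτρ : τ ∈ ball 0 ρ) (hne : τ ≠ 0) :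
    DiffContOnCl ℂ (fun h => dslope (fun τ => F τ h) 0 τ) (ball 0 1) := by
  simp only [dslope_of_ne _ hne, slope_def_module]
  exact ((hh τ hτρ).sub (hh 0 (mem_ball_self hρ))).const_smul _

/-- The derivative in the parameter is again holomorphic in the disc and continuous up to the
boundary. -/
theorem diffContOnCl_deriv_param (hρ : 0 < ρ)
    (hbd : ∀ τ ∈ ball (0 : ℂ) ρ, ∀ h ∈ closedBall (0 : ℂ) 1, ‖F τ h‖ ≤ M)
    (hτ : ∀ h ∈ closedBall (0 : ℂ) 1, DifferentiableOn ℂ (fun τ => F τ h) (ball 0 ρ))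
    (hh : ∀ τ ∈ ball (0 : ℂ) ρ, DiffContOnCl ℂ (F τ) (ball 0 1)) :
    DiffContOnCl ℂ (fun h => deriv (fun τ => F τ h) 0) (ball 0 1) := by
  have hu := tendstoUniformlyOn_dslope hρ hbd hτ
  have hev : ∀ᶠ τ in 𝓝[≠] (0 : ℂ),
      DiffContOnCl ℂ (fun h => dslope (fun τ => F τ h) 0 τ) (ball 0 1) := by
    filter_upwards [self_mem_nhdsWithin, mem_nhdsWithin_of_mem_nhds (ball_mem_nhds (0 : ℂ) hρ)]
      with τ h1 h2
    exact diffContOnCl_dslope hh hρ h2 h1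
  refine DiffContOnCl.mk_ball ?_ ?_
  · exact (hu.mono ball_subset_closedBall).tendstoLocallyUniformlyOn.differentiableOn
      (hev.mono fun _ h => h.1) isOpen_ball
  · exact hu.continuousOn (hev.mono fun _ h => h.continuousOn_ball).frequently

/-- Iterates Weierstrass's theorem; holomorphy of the derivatives is carried along to feed the next
step. -/
theorem tendstoLocallyUniformlyOn_iteratedDeriv {ι : Type*} {l : Filter ι} [l.NeBot] {U : Set ℂ}
    (hU : IsOpen U) {G : ι → ℂ → E} {g : ℂ → E} (h : TendstoLocallyUniformlyOn G g l U)
    (hG : ∀ᶠ i in l, DifferentiableOn ℂ (G i) U) (n : ℕ) :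
    TendstoLocallyUniformlyOn (fun i => iteratedDeriv n (G i)) (iteratedDeriv n g) l U ∧
      ∀ᶠ i in l, DifferentiableOn ℂ (iteratedDeriv n (G i)) U := by
  induction n with
  | zero => simpa using ⟨h, hG⟩
  | succ n ih =>
    simp only [iteratedDeriv_succ]
    exact ⟨ih.1.deriv ih.2 hU, ih.2.mono fun _ h => h.deriv hU⟩

/-- Taking Taylor coefficients commutes with differentiation in a parameter. -/
theorem hasDerivAt_taylorCoeff_param (hρ : 0 < ρ)
    (hbd : ∀ τ ∈ ball (0 : ℂ) ρ, ∀ h ∈ closedBall (0 : ℂ) 1, ‖F τ h‖ ≤ M)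
    (hτ : ∀ h ∈ closedBall (0 : ℂ) 1, DifferentiableOn ℂ (fun τ => F τ h) (ball 0 ρ))
    (hh : ∀ τ ∈ ball (0 : ℂ) ρ, DiffContOnCl ℂ (F τ) (ball 0 1)) (m : ℕ) :
    HasDerivAt (fun τ => taylorCoeff (F τ) m)
      (taylorCoeff (fun h => deriv (fun τ => F τ h) 0) m) 0 := by
  have hu := ((tendstoUniformlyOn_dslope hρ hbd hτ).mono
    ball_subset_closedBall).tendstoLocallyUniformlyOn
  have hev : ∀ᶠ τ in 𝓝[≠] (0 : ℂ), τ ≠ 0 ∧ τ ∈ ball (0 : ℂ) ρ := by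
    filter_upwards [self_mem_nhdsWithin, mem_nhdsWithin_of_mem_nhds (ball_mem_nhds (0 : ℂ) hρ)]
      with τ h1 h2
    exact ⟨h1, h2⟩
  have hlim := ((tendstoLocallyUniformlyOn_iteratedDeriv isOpen_ball hu (hev.mono fun τ h =>
    (diffContOnCl_dslope hh hρ h.2 h.1).1) m).1.tendsto_at
      (mem_ball_self one_pos)).const_smul ((m ! : ℂ)⁻¹)
  rw [hasDerivAt_iff_tendsto_slope]
  refine hlim.congr' (hev.mono fun τ h => ?_)
  have hc : ∀ τ ∈ ball (0 : ℂ) ρ, ContDiffAt ℂ m (F τ) 0 := fun τ h =>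
    (contDiffAt_of_differentiableOn_ball one_pos (hh τ h).1).of_le le_top
  simp only [dslope_of_ne _ h.1, slope_def_module]
  rw [iteratedDeriv_fun_const_smul ((hc τ h.2).sub (hc 0 (mem_ball_self hρ))),
    iteratedDeriv_fun_sub (hc τ h.2) (hc 0 (mem_ball_self hρ)), smul_comm, smul_sub]
  rfl

end Analysis

/-! ### From a Birkhoff factorization to an `h`-independent connection term. -/

section Birkhoff

open Metric Filter Topology

variable {A : Type*} [NormedRing A] [NormedAlgebra ℂ A] [CompleteSpace A]

omit [CompleteSpace A] in
theorem diffContOnCl_mul {f g : ℂ → A} {s : Set ℂ} (hf : DiffContOnCl ℂ f s)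
    (hg : DiffContOnCl ℂ g s) : DiffContOnCl ℂ (fun z => f z * g z) s :=
  ⟨hf.1.mul hg.1, hf.2.mul hg.2⟩

theorem diffContOnCl_ringInverse {f : ℂ → A} (hf : DiffContOnCl ℂ f (ball 0 1))
    (hu : ∀ z ∈ closedBall (0 : ℂ) 1, IsUnit (f z)) :
    DiffContOnCl ℂ (fun z => Ring.inverse (f z)) (ball 0 1) := by
  refine DiffContOnCl.mk_ball (fun z hz => ?_) fun z hz => ?_
  · obtain ⟨v, hv⟩ := hu z (ball_subset_closedBall hz)
    have : DifferentiableAt ℂ Ring.inverse (f z) := hv ▸ differentiableAt_inverse v.isUnit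
    exact this.comp_differentiableWithinAt z (hf.1 z hz)
  · obtain ⟨v, hv⟩ := hu z hz
    have : ContinuousAt Ring.inverse (f z) := hv ▸ NormedRing.inverse_continuousAt v
    exact this.comp_continuousWithinAt (hf.continuousOn_ball z hz)

/-- If a loop `Λ = F₋ F₊` with parameter `τ` satisfies `dΛ/dτ = h⁻¹ Λ W` with `W` holomorphic in
the disc, then `h dF₊/dτ = F₊ W - C F₊` with `C` independent of `h`. -/
theorem exists_connection_of_birkhoff {Fp Fm : ℂ → ℂ → A} {W : ℂ → A} {ρ M₁ M₂ : ℝ} (hρ : 0 < ρ)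
    (hbdp : ∀ τ ∈ ball (0 : ℂ) ρ, ∀ h ∈ closedBall (0 : ℂ) 1, ‖Fp τ h‖ ≤ M₁)
    (hτp : ∀ h ∈ closedBall (0 : ℂ) 1, DifferentiableOn ℂ (fun τ => Fp τ h) (ball 0 ρ))
    (hhp : ∀ τ ∈ ball (0 : ℂ) ρ, DiffContOnCl ℂ (Fp τ) (ball 0 1))
    (hup : ∀ h ∈ closedBall (0 : ℂ) 1, IsUnit (Fp 0 h))
    (hbdm : ∀ τ ∈ ball (0 : ℂ) ρ, ∀ h ∈ closedBall (0 : ℂ) 1, ‖Fm τ h‖ ≤ M₂)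
    (hτm : ∀ h ∈ closedBall (0 : ℂ) 1, DifferentiableOn ℂ (fun τ => Fm τ h) (ball 0 ρ))
    (hhm : ∀ τ ∈ ball (0 : ℂ) ρ, DiffContOnCl ℂ (Fm τ) (ball 0 1))
    (hum : ∀ h ∈ closedBall (0 : ℂ) 1, IsUnit (Fm 0 h))
    (hm0 : ∀ τ ∈ ball (0 : ℂ) ρ, Fm τ 0 = 1)
    (hW : DiffContOnCl ℂ W (ball 0 1))
    (hΛ : ∀ h ∈ sphere (0 : ℂ) 1, HasDerivAt (fun τ => Fm τ h⁻¹ * Fp τ h)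
      (Fm 0 h⁻¹ * Fp 0 h * (h⁻¹ • W h)) 0) :
    ∃ C, ∀ h ∈ ball (0 : ℂ) 1,
      h • deriv (fun τ => Fp τ h) 0 = Fp 0 h * W h - C * Fp 0 h := by
  have h0 : (0 : ℂ) ∈ ball (0 : ℂ) ρ := mem_ball_self hρ
  set D : ℂ → A := fun h => deriv (fun τ => Fp τ h) 0 with hDdef
  set G : ℂ → A := fun h => deriv (fun τ => Fm τ h) 0 with hGdef
  have hD : DiffContOnCl ℂ D (ball 0 1) := diffContOnCl_deriv_param hρ hbdp hτp hhp
  have hG : DiffContOnCl ℂ G (ball 0 1) := diffContOnCl_deriv_param hρ hbdm hτm hhm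
  have hG0 : G 0 = 0 := by
    have : (fun τ => Fm τ 0) =ᶠ[𝓝 0] fun _ => 1 :=
      eventually_of_mem (ball_mem_nhds _ hρ) hm0
    rw [hGdef]
    simp only
    rw [this.deriv_eq, deriv_const]
  -- In the coordinate `z = 1/h` the function `hL₋'` is `G z / z`, regular at infinity because `G 0
  -- = 0`.
  have hds : DiffContOnCl ℂ (dslope G 0) (ball 0 1) := by
    refine DiffContOnCl.mk_ball ?_ ?_
    · exact (Complex.differentiableOn_dslope (ball_mem_nhds _ one_pos)).2 hG.1
    · exact (continuousOn_dslope (closedBall_mem_nhds _ one_pos)).2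
        ⟨hG.continuousOn_ball, hG.1.differentiableAt (ball_mem_nhds _ one_pos)⟩
  have hid : DiffContOnCl ℂ (fun h : ℂ => h) (ball 0 1) := differentiable_id.diffContOnCl
  have h1 : DiffContOnCl ℂ (fun h => (Fp 0 h * W h - h • D h) * Ring.inverse (Fp 0 h))
      (ball 0 1) :=
    diffContOnCl_mul ((diffContOnCl_mul (hhp 0 h0) hW).sub (hid.smul hD))
      (diffContOnCl_ringInverse (hhp 0 h0) hup)
  have h2 : DiffContOnCl ℂ (fun z => Ring.inverse (Fm 0 z) * dslope G 0 z) (ball 0 1) :=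
    diffContOnCl_mul (diffContOnCl_ringInverse (hhm 0 h0) hum) hds
  refine ⟨Ring.inverse (Fm 0 0) * dslope G 0 0, fun h hh => ?_⟩
  -- On the circle the product rule and the equation for the loop give `h G Fp = Fm (Fp W - h D)`,
  -- with `Fm` and `G` taken at `h⁻¹`.
  have key := eq_of_eq_comp_inv_on_sphere h1 h2 (fun h hh => ?_) hh
  · rw [← key, mul_assoc, Ring.inverse_mul_cancel _ (hup h (ball_subset_closedBall hh)), mul_one,
      sub_sub_cancel]
  · have hc := sphere_subset_closedBall hh
    have hne : h ≠ 0 := ne_of_mem_sphere hh one_ne_zero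
    have hc' : h⁻¹ ∈ closedBall (0 : ℂ) 1 := sphere_subset_closedBall (by simpa using hh)
    have e1 := ((hτm _ hc').differentiableAt (ball_mem_nhds _ hρ)).hasDerivAt.mul
      ((hτp _ hc).differentiableAt (ball_mem_nhds _ hρ)).hasDerivAt
    have e2 := e1.unique (hΛ h hh)
    have e3 : h • G h⁻¹ * Fp 0 h = Fm 0 h⁻¹ * (Fp 0 h * W h - h • D h) := by
      have e4 : h • (G h⁻¹ * Fp 0 h + Fm 0 h⁻¹ * D h) =
          h • (Fm 0 h⁻¹ * Fp 0 h * (h⁻¹ • W h)) := congrArg _ e2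
      rw [mul_smul_comm, smul_smul, mul_inv_cancel₀ hne, one_smul, smul_add] at e4
      rw [smul_mul_assoc, mul_sub, ← mul_assoc, ← e4, mul_smul_comm, add_sub_cancel_right]
    have e5 : dslope G 0 h⁻¹ = h • G h⁻¹ := by
      rw [dslope_of_ne _ (inv_ne_zero hne), slope_def_module, hG0, sub_zero, sub_zero, inv_inv]
    rw [e5, ← mul_one (h • G h⁻¹), ← Ring.mul_inverse_cancel _ (hup h hc), ← mul_assoc (h • G h⁻¹),
      e3, ← mul_assoc, ← mul_assoc, Ring.inverse_mul_cancel _ (hum _ hc'), one_mul]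

end Birkhoff

attribute [local instance] Matrix.linftyOpNormedRing Matrix.linftyOpNormedAlgebra

/-! ### Entrywise calculus for matrix-valued functions. -/

section MatrixCalculus

open Metric Filter Topology

variable {n : ℕ} {V : Type*} [NormedAddCommGroup V] [NormedSpace ℂ V]

theorem differentiableOn_matrix {F : V → Matrix (Fin n) (Fin n) ℂ} {S : Set V}
    (h : ∀ k j, DifferentiableOn ℂ (fun x => F x k j) S) : DifferentiableOn ℂ F S := by
  have : F = fun x => ∑ k, ∑ j, F x k j • Matrix.single k j (1 : ℂ) := by
    ext1 x
    conv_lhs => rw [Matrix.matrix_eq_sum_single (F x)]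
    simp
  rw [this]
  exact DifferentiableOn.fun_sum fun k _ => DifferentiableOn.fun_sum fun j _ =>
    (h k j).smul_const _

theorem hasDerivAt_matrix {F : ℂ → Matrix (Fin n) (Fin n) ℂ} {F' : Matrix (Fin n) (Fin n) ℂ}
    {x : ℂ} (h : ∀ k j, HasDerivAt (fun x => F x k j) (F' k j) x) : HasDerivAt F F' x := by
  have : ∀ B : Matrix (Fin n) (Fin n) ℂ,
      B = ∑ k, ∑ j, B k j • Matrix.single k j (1 : ℂ) := fun B => by
    conv_lhs => rw [Matrix.matrix_eq_sum_single B]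
    simp
  rw [show F = fun x => ∑ k, ∑ j, F x k j • Matrix.single k j (1 : ℂ) from
    funext fun x => this (F x), this F']
  exact HasDerivAt.fun_sum fun k _ => HasDerivAt.fun_sum fun j _ => (h k j).smul_const _

/-- The matrix entries as continuous linear functionals. -/
noncomputable def entryCLM (k j : Fin n) : Matrix (Fin n) (Fin n) ℂ →L[ℂ] ℂ :=
  LinearMap.toContinuousLinearMap (Matrix.entryLinearMap ℂ ℂ k j)

theorem entryCLM_apply (k j : Fin n) (B : Matrix (Fin n) (Fin n) ℂ) : entryCLM k j B = B k j := rfl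

theorem taylorCoeff_entry {f : ℂ → Matrix (Fin n) (Fin n) ℂ} {R : ℝ} (hR : 0 < R)
    (hf : DifferentiableOn ℂ f (ball 0 R)) (m : ℕ) (k j : Fin n) :
    taylorCoeff (fun z => f z k j) m = taylorCoeff f m k j := by
  refine taylorCoeff_eq_of_hasSum (c := fun m => taylorCoeff f m k j) hR (fun z hz => ?_) m
  have := (entryCLM k j).hasSum (hasSum_taylorCoeff hf hz)
  simpa [entryCLM_apply, Function.comp_def] using this

theorem taylorCoeff_polynomial (p : Polynomial ℂ) (m : ℕ) :
    taylorCoeff (fun z => p.eval z) m = p.coeff m := by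
  refine taylorCoeff_eq_of_hasSum (c := p.coeff) one_pos (fun z _ => ?_) m
  rw [Polynomial.eval_eq_sum_range]
  have := hasSum_sum_of_ne_finset_zero (L := SummationFilter.unconditional ℕ) (f := fun n => z ^ n • p.coeff n)
    (s := Finset.range (p.natDegree + 1)) (fun b hb => by
      rw [Polynomial.coeff_eq_zero_of_natDegree_lt (by simpa using hb), smul_zero])
  simpa [mul_comm] using this

end MatrixCalculus

/-! ### The identity theorem in several variables. -/

section IdentityTheorem

open Metric Filter Topology

/-- The identity theorem for functions which are holomorphic along complex lines. -/
theorem eqOn_zero_of_line_differentiable {V : Type*} [NormedAddCommGroup V] [NormedSpace ℂ V]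
    {U : Set V} (hUo : IsOpen U) (hUc : IsPreconnected U) {f : V → ℂ}
    (hf : ∀ x ∈ U, ∀ v, DifferentiableAt ℂ (fun τ : ℂ => f (x + τ • v)) 0)
    {O : Set V} (hO : IsOpen O) (hOU : (U ∩ O).Nonempty) (hfO : ∀ x ∈ O, f x = 0) :
    ∀ x ∈ U, f x = 0 := by
  suffices U ⊆ {x | ∀ᶠ y in 𝓝 x, f y = 0} from fun x hx => (this hx).self_of_nhds
  -- The interior of the zero set is open, meets `U`, and is relatively closed in `U`: near a limit
  -- point, join a nearby interior zero `y` to any `p` by a complex line and apply the one-variable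
  -- theorem on the convex slice of a ball.
  refine hUc.subset_of_closure_inter_subset isOpen_setOfPred_eventually_nhds ?_ ?_
  · obtain ⟨x, hxU, hxO⟩ := hOU
    exact ⟨x, hxU, eventually_of_mem (hO.mem_nhds hxO) hfO⟩
  · rintro x ⟨hxcl, hxU⟩
    obtain ⟨ε, hε, hball⟩ := Metric.isOpen_iff.1 hUo x hxU
    obtain ⟨y, hy, hyx⟩ := Metric.mem_closure_iff.1 hxcl ε hε
    refine eventually_of_mem (ball_mem_nhds x hε) fun p hp => ?_
    have hyb : y ∈ ball x ε := by rwa [mem_ball, dist_comm]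
    set γ : ℂ → V := fun τ => y + τ • (p - y) with hγ
    have hγc : Continuous γ := by fun_prop
    set T : Set ℂ := γ ⁻¹' ball x ε with hT
    have hTc : Convex ℝ T := by
      intro a ha b hb s t hs ht hst
      have : γ (s • a + t • b) = s • γ a + t • γ b := by
        simp only [hγ, smul_add]
        rw [add_add_add_comm, ← add_smul, hst, one_smul, add_smul, smul_assoc, smul_assoc]
      rw [hT, Set.mem_preimage, this]
      exact convex_ball x ε ha hb hs ht hst
    have hd : DifferentiableOn ℂ (fun τ => f (γ τ)) T := by
      intro τ hτ
      have h1 := hf (γ τ) (hball hτ) (p - y)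
      have h2 : (fun τ' => f (γ τ')) = fun τ' => (fun σ : ℂ => f (γ τ + σ • (p - y))) (τ' - τ) := by
        ext τ'
        simp only [hγ, sub_smul]
        congr 1
        abel
      rw [h2]
      have h3 : DifferentiableAt ℂ (fun σ : ℂ => f (γ τ + σ • (p - y))) (τ - τ) := by
        simpa using h1
      exact (h3.comp τ (f := fun τ' => τ' - τ) (by fun_prop)).differentiableWithinAt
    have h0 : γ 0 = y := by simp [hγ]
    have h1 : γ 1 = p := by simp [hγ]
    have han : AnalyticOnNhd ℂ (fun τ => f (γ τ)) T :=
      hd.analyticOnNhd (isOpen_ball.preimage hγc)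
    have hz : (fun τ => f (γ τ)) =ᶠ[𝓝 0] 0 := by
      have := hγc.tendsto 0
      rw [h0] at this
      exact this.eventually hy
    have := han.eqOn_zero_of_preconnected_of_eventuallyEq_zero hTc.isPreconnected
      (by simpa [hT, h0] using hyb) hz (x := 1) (by simpa [hT, h1] using hp)
    simpa [h1] using this

end IdentityTheorem

/-! ### Disc families along curves in the parameter space. -/

section DiscFamilies

open Metric Filter Topology

variable {r n : ℕ} {S : Set (Fin r → ℂ)} {F : (Fin r → ℂ) → ℂ → Matrix (Fin n) (Fin n) ℂ}

theorem IsDiscFamily.diffContOnCl (hF : IsDiscFamily S F) {x : Fin r → ℂ} (hx : x ∈ S) :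
    DiffContOnCl ℂ (F x) (ball 0 1) := by
  refine DiffContOnCl.mk_ball (differentiableOn_matrix (hF.holomorphic_disc x hx)) ?_
  exact hF.continuousOn.comp (f := fun z => (x, z)) (by fun_prop) fun z hz => ⟨hx, hz⟩

/-- A disc family restricted to a small disc in the parameter space. -/
theorem IsDiscFamily.exists_bound (hF : IsDiscFamily S F) (hS : IsOpen S)
    {γ : ℂ → Fin r → ℂ} (hγ : Differentiable ℂ γ) (h0 : γ 0 ∈ S) :
    ∃ ρ > 0, (∀ τ ∈ ball (0 : ℂ) ρ, γ τ ∈ S) ∧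
      (∃ M : ℝ, ∀ τ ∈ ball (0 : ℂ) ρ, ∀ h ∈ closedBall (0 : ℂ) 1, ‖F (γ τ) h‖ ≤ M) ∧
      (∀ h ∈ closedBall (0 : ℂ) 1, DifferentiableOn ℂ (fun τ => F (γ τ) h) (ball 0 ρ)) ∧
      (∀ τ ∈ ball (0 : ℂ) ρ, DiffContOnCl ℂ (F (γ τ)) (ball 0 1)) := by
  have hpre : γ ⁻¹' S ∈ 𝓝 0 := hγ.continuous.continuousAt.preimage_mem_nhds (hS.mem_nhds h0)
  obtain ⟨ρ, hρ, hsub⟩ := nhds_basis_closedBall.mem_iff.1 hpre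
  have hmem : ∀ τ ∈ ball (0 : ℂ) ρ, γ τ ∈ S := fun τ hτ => hsub (ball_subset_closedBall hτ)
  refine ⟨ρ, hρ, hmem, ?_, fun h hh => ?_, fun τ hτ => hF.diffContOnCl (hmem τ hτ)⟩
  · have hc : ContinuousOn (fun p : ℂ × ℂ => F (γ p.1) p.2) (closedBall 0 ρ ×ˢ closedBall 0 1) :=
      hF.continuousOn.comp (f := fun p : ℂ × ℂ => (γ p.1, p.2))
        ((hγ.continuous.comp continuous_fst).prodMk continuous_snd).continuousOn
        fun p hp => ⟨hsub hp.1, hp.2⟩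
    obtain ⟨M, hM⟩ := ((isCompact_closedBall 0 ρ).prod
      (isCompact_closedBall 0 1)).exists_bound_of_continuousOn hc
    exact ⟨M, fun τ hτ h hh => hM (τ, h) ⟨ball_subset_closedBall hτ, hh⟩⟩
  · exact (differentiableOn_matrix (hF.holomorphic_param h hh)).comp hγ.differentiableOn hmem

/-- The Taylor coefficients of a disc family are holomorphic along lines. -/
theorem IsDiscFamily.hasDerivAt_taylorCoeff (hF : IsDiscFamily S F) (hS : IsOpen S)
    {x : Fin r → ℂ} (hx : x ∈ S) (v : Fin r → ℂ) (m : ℕ) :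
    HasDerivAt (fun τ : ℂ => taylorCoeff (F (x + τ • v)) m)
      (taylorCoeff (fun h => deriv (fun τ : ℂ => F (x + τ • v) h) 0) m) 0 := by
  obtain ⟨ρ, hρ, -, ⟨M, hM⟩, h1, h2⟩ := hF.exists_bound hS (γ := fun τ : ℂ => x + τ • v)
    (by fun_prop) (by simpa using hx)
  exact hasDerivAt_taylorCoeff_param hρ hM h1 h2 m

theorem IsDiscFamily.differentiableAt_line (hF : IsDiscFamily S F) (hS : IsOpen S)
    {x : Fin r → ℂ} (hx : x ∈ S) (v : Fin r → ℂ) {h : ℂ} (hh : h ∈ closedBall (0 : ℂ) 1) :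
    DifferentiableAt ℂ (fun τ : ℂ => F (x + τ • v) h) 0 := by
  obtain ⟨ρ, hρ, -, -, h1, -⟩ := hF.exists_bound hS (γ := fun τ : ℂ => x + τ • v)
    (by fun_prop) (by simpa using hx)
  exact (h1 h hh).differentiableAt (ball_mem_nhds _ hρ)

end DiscFamilies

/-! ### The differential equation of `L₊` along lines through the origin. -/

section RadialEquation

open Metric Filter Topology

variable {r n : ℕ}

/-- The matrix `∑_i hΩ_i` at the point `x`. -/
noncomputable def eulerMatrix
    (W : Fin r → Matrix (Fin n) (Fin n) (Polynomial (MvPolynomial (Fin r) ℂ)))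
    (x : Fin r → ℂ) (h : ℂ) : Matrix (Fin n) (Fin n) ℂ :=
  ∑ i, (W i).map fun p => (p.map (MvPolynomial.eval x)).eval h

/-- The coefficient of `h^m` in `∑_i hΩ_i` at the point `x`. -/
noncomputable def eulerMatrixCoeff
    (W : Fin r → Matrix (Fin n) (Fin n) (Polynomial (MvPolynomial (Fin r) ℂ)))
    (m : ℕ) (x : Fin r → ℂ) : Matrix (Fin n) (Fin n) ℂ :=
  Matrix.of fun k j => MvPolynomial.eval x ((∑ i, W i k j).coeff m)

variable (W : Fin r → Matrix (Fin n) (Fin n) (Polynomial (MvPolynomial (Fin r) ℂ)))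

theorem eulerMatrix_apply (x : Fin r → ℂ) (h : ℂ) (k j : Fin n) :
    eulerMatrix W x h k j = ((∑ i, W i k j).map (MvPolynomial.eval x)).eval h := by
  simp [eulerMatrix, Matrix.sum_apply, Polynomial.map_sum, Polynomial.eval_finsetSum]

theorem differentiable_eulerMatrix (x : Fin r → ℂ) : Differentiable ℂ (eulerMatrix W x) := by
  rw [← differentiableOn_univ]
  refine differentiableOn_matrix fun k j => ?_
  simp only [eulerMatrix_apply]
  exact (Polynomial.differentiable _).differentiableOn

theorem taylorCoeff_eulerMatrix (x : Fin r → ℂ) (m : ℕ) :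
    taylorCoeff (eulerMatrix W x) m = eulerMatrixCoeff W m x := by
  ext k j
  rw [← taylorCoeff_entry one_pos (differentiable_eulerMatrix W x).differentiableOn]
  simp only [eulerMatrix_apply, taylorCoeff_polynomial, Polynomial.coeff_map]
  rfl

theorem differentiable_eulerMatrixCoeff_line (m : ℕ) (x : Fin r → ℂ) :
    Differentiable ℂ fun z : ℂ => eulerMatrixCoeff W m (z • x) := by
  rw [← differentiableOn_univ]
  refine differentiableOn_matrix fun k j => Differentiable.differentiableOn ?_
  simp only [eulerMatrixCoeff, Matrix.of_apply]
  generalize (∑ i, W i k j).coeff m = p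
  induction p using MvPolynomial.induction_on with
  | C a => simp
  | add p q hp hq => simp only [map_add]; exact hp.add hq
  | mul_X p i hp =>
    simp only [map_mul, MvPolynomial.eval_X, Pi.smul_apply, smul_eq_mul]
    exact hp.mul (by fun_prop)

theorem isOpen_tRegion {U : Set (Fin r → ℂ)} (hU : IsOpen U) : IsOpen (tRegion U) :=
  hU.preimage (continuous_pi fun i => Complex.continuous_exp.comp (continuous_apply i))

theorem expT_add_smul_one (t : Fin r → ℂ) (τ : ℂ) :
    expT (t + τ • (1 : Fin r → ℂ)) = Complex.exp τ • expT t := by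
  ext i
  simp [expT, Complex.exp_add, mul_comm]

variable {W}

/-- The loop `L` satisfies the differential equation in the direction of the Euler field. -/
theorem IsLoopSolution.hasDerivAt {S : Set (Fin r → ℂ)}
    {L : (Fin r → ℂ) → ℂ → Matrix (Fin n) (Fin n) ℂ} (hL : IsLoopSolution W S L) (hS : IsOpen S)
    {t : Fin r → ℂ} (ht : t ∈ S) {h : ℂ} (hh : h ∈ sphere (0 : ℂ) 1) :
    HasDerivAt (fun τ : ℂ => L (t + τ • (1 : Fin r → ℂ)) h)
      (L t h * (h⁻¹ • eulerMatrix W (expT t) h)) 0 := by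
  refine hasDerivAt_matrix fun k j => ?_
  have h1 := ((hL.differentiableOn h hh k j).differentiableAt (hS.mem_nhds ht)).hasFDerivAt
  have h2 : HasDerivAt (fun τ : ℂ => t + τ • (1 : Fin r → ℂ)) 1 0 := by
    simpa using ((hasDerivAt_id (0 : ℂ)).smul_const (1 : Fin r → ℂ)).const_add t
  have h3 := HasFDerivAt.comp_hasDerivAt_of_eq (0 : ℂ) h1 h2 (by simp)
  have h4 : (1 : Fin r → ℂ) = ∑ i, Pi.single i 1 := (Finset.univ_sum_single (1 : Fin r → ℂ)).symm
  have h5 : fderiv ℂ (fun t => L t h k j) t 1 =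
      (L t h * (h⁻¹ • eulerMatrix W (expT t) h)) k j := by
    rw [h4, map_sum]
    simp only [hL.deriv_eq t ht h hh, ← Matrix.sum_apply, ← Finset.mul_sum, omegaAt,
      ← Finset.smul_sum, eulerMatrix]
  exact h5 ▸ h3

/-- The equation satisfied by `L₊` along complex lines through the origin. -/
theorem exists_radial_equation {U : Set (Fin r → ℂ)} (hUo : IsOpen U)
    {L Lm Lp : (Fin r → ℂ) → ℂ → Matrix (Fin n) (Fin n) ℂ}
    (hL : IsLoopSolution W (tRegion U) L) (hB : IsBirkhoff U L Lm Lp)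
    {x : Fin r → ℂ} (hx : ∀ i, x i ≠ 0) (hxU : x ∈ U) :
    ∃ C, ∀ h ∈ ball (0 : ℂ) 1, h • deriv (fun τ : ℂ => Lp (x + τ • x) h) 0 =
      Lp x h * eulerMatrix W x h - C * Lp x h := by
  obtain ⟨t, rfl⟩ : ∃ t, x = expT t :=
    ⟨fun i => Complex.log (x i), funext fun i => (Complex.exp_log (hx i)).symm⟩
  have hS := isOpen_tRegion hUo
  have hexp : Differentiable ℂ fun τ : ℂ => Complex.exp τ • expT t := by fun_prop
  obtain ⟨ρ₁, hρ₁, hmem₁, ⟨M₁, hM₁⟩, h11, h12⟩ := hB.plus.exists_bound hUo hexp (by simpa using hxU)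
  obtain ⟨ρ₂, hρ₂, hmem₂, ⟨M₂, hM₂⟩, h21, h22⟩ := hB.minus.exists_bound hS
    (γ := fun τ : ℂ => t + τ • (1 : Fin r → ℂ)) (by fun_prop)
    (by simpa [tRegion] using hxU)
  set ρ := min ρ₁ ρ₂
  have hρ : 0 < ρ := lt_min hρ₁ hρ₂
  have s1 : ball (0 : ℂ) ρ ⊆ ball 0 ρ₁ := ball_subset_ball (min_le_left _ _)
  have s2 : ball (0 : ℂ) ρ ⊆ ball 0 ρ₂ := ball_subset_ball (min_le_right _ _)
  obtain ⟨C, hC⟩ := exists_connection_of_birkhoff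
    (Fp := fun τ h => Lp (Complex.exp τ • expT t) h)
    (Fm := fun τ h => Lm (t + τ • (1 : Fin r → ℂ)) h) (W := eulerMatrix W (expT t)) hρ
    (fun τ hτ => hM₁ τ (s1 hτ)) (fun h hh => (h11 h hh).mono s1) (fun τ hτ => h12 τ (s1 hτ))
    (fun h hh => by simpa using hB.plus.isUnit _ hxU h hh)
    (fun τ hτ => hM₂ τ (s2 hτ)) (fun h hh => (h21 h hh).mono s2) (fun τ hτ => h22 τ (s2 hτ))
    (fun h hh => by simpa using hB.minus.isUnit t hxU h hh)
    (fun τ hτ => hB.minus_infty _ (hmem₂ τ (s2 hτ)))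
    (differentiable_eulerMatrix W _).diffContOnCl
    (fun h hh => by
      have h1 := hL.hasDerivAt hS (show t ∈ tRegion U from hxU) hh
      have h2 : (fun τ : ℂ => L (t + τ • (1 : Fin r → ℂ)) h) =ᶠ[𝓝 0]
          fun τ => Lm (t + τ • (1 : Fin r → ℂ)) h⁻¹ * Lp (Complex.exp τ • expT t) h := by
        refine eventually_of_mem (ball_mem_nhds _ hρ) fun τ hτ => ?_
        simp only [← expT_add_smul_one]
        exact hB.factor _ (hmem₂ τ (s2 hτ)) h hh
      have h3 := h2.hasDerivAt_iff.1 h1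
      rw [hB.factor t hxU h hh] at h3
      simpa using h3)
  refine ⟨C, fun h hh => ?_⟩
  have h1 := hC h hh
  simp only [Complex.exp_zero, one_smul] at h1
  rw [← h1]
  congr 1
  have h2 := (hB.plus.differentiableAt_line hUo hxU (expT t)
    (ball_subset_closedBall hh)).hasDerivAt
  -- The exponential curve `exp τ • x` and the straight line `x + τ • x` have the same tangent at `τ
  -- = 0`.
  have h3 : HasDerivAt (fun τ => Complex.exp τ - 1) 1 0 := by
    simpa using (Complex.hasDerivAt_exp 0).sub_const 1
  have h4 := HasDerivAt.scomp_of_eq (0 : ℂ) h2 h3 (by simp)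
  rw [one_smul] at h4
  refine h4.deriv.symm.trans (congrArg (fun f => deriv f 0) (funext fun τ => ?_))
  simp only [Function.comp_apply, sub_smul, one_smul, add_sub_cancel]

/-- The coefficient of `h^0` contains no derivative and determines `C`; substituting it into the
coefficient of `h^(m+1)` yields the formula. -/
theorem radial_coefficient_equation {U : Set (Fin r → ℂ)} (hUo : IsOpen U)
    {L Lm Lp : (Fin r → ℂ) → ℂ → Matrix (Fin n) (Fin n) ℂ}
    (hL : IsLoopSolution W (tRegion U) L) (hB : IsBirkhoff U L Lm Lp)
    {x : Fin r → ℂ} (hx : ∀ i, x i ≠ 0) (hxU : x ∈ U) (m : ℕ) :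
    deriv (fun τ : ℂ => taylorCoeff (Lp (x + τ • x)) m) 0 =
      ∑ y ∈ Finset.HasAntidiagonal.antidiagonal (m + 1),
        taylorCoeff (Lp x) y.1 * eulerMatrixCoeff W y.2 x -
      taylorCoeff (Lp x) 0 * eulerMatrixCoeff W 0 x * Ring.inverse (taylorCoeff (Lp x) 0) *
        taylorCoeff (Lp x) (m + 1) := by
  obtain ⟨C, hC⟩ := exists_radial_equation hUo hL hB hx hxU
  obtain ⟨ρ, hρ, -, ⟨M, hM⟩, h1, h2⟩ := hB.plus.exists_bound hUo (γ := fun τ : ℂ => x + τ • x)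
    (by fun_prop) (by simpa using hxU)
  have hD := (diffContOnCl_deriv_param hρ hM h1 h2).1
  have hP := (hB.plus.diffContOnCl hxU).1
  have cP := contDiffAt_of_differentiableOn_ball one_pos hP
  have cW := contDiffAt_of_differentiableOn_ball (R := 1) one_pos
    (differentiable_eulerMatrix W x).differentiableOn
  have hev : ∀ m, taylorCoeff (fun h => h • deriv (fun τ : ℂ => Lp (x + τ • x) h) 0) m =
      ∑ y ∈ Finset.HasAntidiagonal.antidiagonal m,
        taylorCoeff (Lp x) y.1 * eulerMatrixCoeff W y.2 x - C * taylorCoeff (Lp x) m := by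
    intro m
    rw [taylorCoeff_congr (eventually_of_mem (ball_mem_nhds _ one_pos) hC),
      taylorCoeff_sub (cP.mul cW) (contDiffAt_const.mul cP), taylorCoeff_mul cP cW]
    simp only [taylorCoeff_eulerMatrix]
    congr 1
    refine taylorCoeff_eq_of_hasSum (c := fun m => C * taylorCoeff (Lp x) m) one_pos
      (fun z hz => ?_) m
    simpa only [mul_smul_comm] using (hasSum_taylorCoeff hP hz).mul_left C
  have hC' : C = taylorCoeff (Lp x) 0 * eulerMatrixCoeff W 0 x *
      Ring.inverse (taylorCoeff (Lp x) 0) := by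
    have h0 := hev 0
    rw [taylorCoeff_zero, zero_smul] at h0
    have hu : IsUnit (taylorCoeff (Lp x) 0) := by
      rw [taylorCoeff_zero]
      exact hB.plus.isUnit x hxU 0 (mem_closedBall_self zero_le_one)
    have h1 : taylorCoeff (Lp x) 0 * eulerMatrixCoeff W 0 x = C * taylorCoeff (Lp x) 0 := by
      simpa using (sub_eq_zero.1 h0.symm)
    rw [h1, mul_assoc, Ring.mul_inverse_cancel _ hu, mul_one]
  refine (hB.plus.hasDerivAt_taylorCoeff hUo hxU x m).deriv.trans ?_
  refine (taylorCoeff_id_smul_succ one_pos hD m).symm.trans ((hev _).trans ?_)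
  rw [hC']

end RadialEquation

/-! ### Block bounds for `L₊` and its factors. -/

section Grading

open Metric Filter Topology

variable {r n : ℕ} {W : Fin r → Matrix (Fin n) (Fin n) (Polynomial (MvPolynomial (Fin r) ℂ))}
  {degq : Fin r → ℤ} {deg : Fin n → ℕ}

theorem eulerMatrixCoeff_zero_apply_ne_zero
    (hW : ∀ i k j l m, ((W i k j).coeff l).coeff m ≠ 0 →
      2 * (l : ℤ) + ∑ p, degq p * m p = 2 + 2 * deg j - 2 * deg k) (x : Fin r → ℂ) (k j : Fin n)
    (h : taylorCoeff (fun z : ℂ => eulerMatrixCoeff W 0 (z • x)) 0 k j ≠ 0) :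
    deg k = deg j + 1 := by
  rw [taylorCoeff_zero, zero_smul] at h
  simp only [eulerMatrixCoeff, Matrix.of_apply, Polynomial.finsetSum_coeff, map_sum] at h
  obtain ⟨i, -, hi⟩ := Finset.exists_ne_zero_of_sum_ne_zero h
  have h1 : ((W i k j).coeff 0).coeff 0 ≠ 0 := by
    rwa [← MvPolynomial.constantCoeff_eq, ← MvPolynomial.eval_zero]
  have h2 := hW i k j 0 0 h1
  simp only [Finsupp.coe_zero, Pi.zero_apply, Nat.cast_zero, mul_zero,
    Finset.sum_const_zero, add_zero] at h2
  omega

/-- A monomial with a positive power of some `q_p` has `q`-weight at least 4, so `2m + 4 ≤ 2 + 2 deg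
j - 2 deg k`. Outside the allowed blocks the entry is therefore constant in `q`. -/
theorem taylorCoeff_eulerMatrixCoeff_mem (hdegq : ∀ i, 4 ≤ degq i)
    (hW : ∀ i k j l m, ((W i k j).coeff l).coeff m ≠ 0 →
      2 * (l : ℤ) + ∑ p, degq p * m p = 2 + 2 * deg j - 2 * deg k) (x : Fin r → ℂ) (m N : ℕ) :
    taylorCoeff (fun z : ℂ => eulerMatrixCoeff W m (z • x)) (N + 1) ∈
      upperBlocks deg (m + 1) := by
  intro k j hkj
  rw [← taylorCoeff_entry one_pos (differentiable_eulerMatrixCoeff_line W m x).differentiableOn]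
  have hC : ∀ i, (W i k j).coeff m = MvPolynomial.C (((W i k j).coeff m).coeff 0) := by
    intro i
    ext d
    rw [MvPolynomial.coeff_C]
    split_ifs with hd
    · rw [hd]
    · by_contra hne
      have h1 := hW i k j m d hne
      obtain ⟨p, hp⟩ := DFunLike.ne_iff.1 (Ne.symm hd)
      have h2 : (4 : ℤ) ≤ ∑ p, degq p * d p := by
        refine le_trans ?_ (Finset.single_le_sum (f := fun p => degq p * (d p : ℤ))
          (fun p _ => mul_nonneg (by linarith [hdegq p]) (Int.natCast_nonneg _))
          (Finset.mem_univ p))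
        have h3 : (1 : ℤ) ≤ d p := by
          have : d p ≠ 0 := hp
          omega
        nlinarith [hdegq p]
      omega
  have hconst : (fun z : ℂ => eulerMatrixCoeff W m (z • x) k j) =
      fun z : ℂ => (Polynomial.C (∑ i, ((W i k j).coeff m).coeff 0)).eval z := by
    ext z
    simp only [eulerMatrixCoeff, Matrix.of_apply, Polynomial.finsetSum_coeff, map_sum,
      Polynomial.eval_finsetSum, Polynomial.eval_C]
    refine Finset.sum_congr rfl fun i _ => ?_
    rw [hC i, MvPolynomial.eval_C, MvPolynomial.coeff_C, if_pos rfl]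
  rw [hconst, taylorCoeff_polynomial, Polynomial.coeff_C_succ]

/-- The coefficients of `L₊` lie in the expected blocks, at generic points near `q = 0`. -/
theorem taylorCoeff_sub_mem_of_generic (hdegq : ∀ i, 4 ≤ degq i)
    (hW : ∀ i k j l m, ((W i k j).coeff l).coeff m ≠ 0 →
      2 * (l : ℤ) + ∑ p, degq p * m p = 2 + 2 * deg j - 2 * deg k)
    {U : Set (Fin r → ℂ)} (hUo : IsOpen U)
    {L Lm Lp : (Fin r → ℂ) → ℂ → Matrix (Fin n) (Fin n) ℂ}
    (hL : IsLoopSolution W (tRegion U) L) (hB : IsBirkhoff U L Lm Lp)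
    (hnorm : ∀ h ∈ closedBall (0 : ℂ) 1, Lp 0 h = 1)
    {x : Fin r → ℂ} (hx : ∀ i, x i ≠ 0) (hxU : ∀ z ∈ ball (0 : ℂ) 2, z • x ∈ U) (m : ℕ) :
    taylorCoeff (Lp x) m - (if m = 0 then 1 else 0) ∈ upperBlocks deg (m + 2) := by
  -- Radius 2 puts `z = 1`, the point of interest, inside the disc of convergence.
  have hR : (0 : ℝ) < 2 := two_pos
  set M : ℕ → ℂ → Matrix (Fin n) (Fin n) ℂ := fun m z => taylorCoeff (Lp (z • x)) m with hMdef
  set w : ℕ → ℂ → Matrix (Fin n) (Fin n) ℂ := fun m z => eulerMatrixCoeff W m (z • x) with hwdef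
  have hMd : ∀ m, DifferentiableOn ℂ (M m) (ball 0 2) := by
    intro m z hz
    have h1 := (hB.plus.hasDerivAt_taylorCoeff hUo (hxU z hz) x m).differentiableAt
    have h2 : DifferentiableAt ℂ (fun τ : ℂ => taylorCoeff (Lp (z • x + τ • x)) m) (z - z) := by
      rw [sub_self]
      exact h1
    have h3 := h2.comp z (f := fun τ => τ - z) (by fun_prop)
    refine DifferentiableAt.differentiableWithinAt (h3.congr_of_eventuallyEq ?_)
    refine Eventually.of_forall fun τ => ?_
    simp only [hMdef, Function.comp_apply, ← add_smul, add_sub_cancel]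
  have hM00 : ∀ m, M m 0 = if m = 0 then 1 else 0 := by
    intro m
    have h1 : taylorCoeff (Lp 0) m = taylorCoeff
        (fun z : ℂ => (1 : Matrix (Fin n) (Fin n) ℂ)) m :=
      taylorCoeff_congr (eventually_of_mem (ball_mem_nhds _ one_pos)
        fun h hh => hnorm h (ball_subset_closedBall hh)) m
    simp only [hMdef, zero_smul]
    rw [h1, taylorCoeff, iteratedDeriv_const]
    split_ifs with h <;> simp [h]
  have hwd : ∀ m, DifferentiableOn ℂ (w m) (ball 0 2) := fun m =>
    (differentiable_eulerMatrixCoeff_line W m x).differentiableOn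
  have hMu : ∀ z ∈ ball (0 : ℂ) 2, IsUnit (M 0 z) := fun z hz => by
    simp only [hMdef, taylorCoeff_zero]
    exact hB.plus.isUnit _ (hxU z hz) 0 (mem_closedBall_self zero_le_one)
  set C : ℂ → Matrix (Fin n) (Fin n) ℂ := fun z => M 0 z * w 0 z * Ring.inverse (M 0 z) with hCdef
  have hCd : DifferentiableOn ℂ C (ball 0 2) := by
    refine ((hMd 0).mul (hwd 0)).mul fun z hz => ?_
    obtain ⟨v, hv⟩ := hMu z hz
    have : DifferentiableAt ℂ Ring.inverse (M 0 z) := hv ▸ differentiableAt_inverse v.isUnit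
    exact this.comp_differentiableWithinAt z (hMd 0 z hz)
  have hCM : ∀ z ∈ ball (0 : ℂ) 2, M 0 z * w 0 z = C z * M 0 z := fun z hz => by
    rw [hCdef]
    simp only
    rw [mul_assoc (M 0 z * w 0 z), Ring.inverse_mul_cancel _ (hMu z hz), mul_one]
  set R : ℕ → ℂ → Matrix (Fin n) (Fin n) ℂ := fun m z =>
    ∑ y ∈ Finset.HasAntidiagonal.antidiagonal (m + 1), M y.1 z * w y.2 z - C z * M (m + 1) z
    with hRdef
  have hRd : ∀ m, DifferentiableOn ℂ (R m) (ball 0 2) := fun m =>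
    (DifferentiableOn.fun_sum fun y _ => (hMd y.1).mul (hwd y.2)).sub (hCd.mul (hMd _))
  have hdM : ∀ m, DifferentiableOn ℂ (deriv (M m)) (ball 0 2) := fun m =>
    (hMd m).deriv isOpen_ball
  have heq : ∀ m, ∀ z ∈ ball (0 : ℂ) 2, z ≠ 0 → z • deriv (M m) z = R m z := by
    intro m z hz hz0
    have h1 := radial_coefficient_equation hUo hL hB (x := z • x)
      (fun i => mul_ne_zero hz0 (hx i)) (hxU z hz) m
    refine Eq.trans ?_ h1
    have h2 := ((hMd m).differentiableAt (isOpen_ball.mem_nhds hz)).hasDerivAt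
    have h3 : HasDerivAt (fun τ : ℂ => z + τ * z) z 0 := by
      simpa using ((hasDerivAt_id (0 : ℂ)).mul_const z).const_add z
    have h4 := HasDerivAt.scomp_of_eq (0 : ℂ) h2 h3 (by simp)
    refine h4.deriv.symm.trans (congrArg (fun f => deriv f 0) (funext fun τ => ?_))
    simp only [hMdef, Function.comp_apply, add_smul, mul_smul]
  -- The equation comes from logarithmic coordinates and is known only for `z ≠ 0`; continuity of
  -- both sides extends it to the origin.
  have heq' : ∀ m, (fun z => z • deriv (M m) z) =ᶠ[𝓝 0] R m := by
    intro m
    have hb := ball_mem_nhds (0 : ℂ) hR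
    have h1 : ContinuousAt (fun z => z • deriv (M m) z) 0 :=
      continuousAt_id.smul ((hdM m).differentiableAt hb).continuousAt
    have h2 : ContinuousAt (R m) 0 := ((hRd m).differentiableAt hb).continuousAt
    refine (h1.eventuallyEq_nhds_iff_eventuallyEq_nhdsNE h2).1 ?_
    filter_upwards [self_mem_nhdsWithin, mem_nhdsWithin_of_mem_nhds hb] with z h3 h4
    exact heq m z h4 h3
  have cM := fun m => contDiffAt_of_differentiableOn_ball hR (hMd m)
  have cw := fun m => contDiffAt_of_differentiableOn_ball hR (hwd m)
  have cC := contDiffAt_of_differentiableOn_ball hR hCd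
  have hrec : ∀ m N : ℕ, (N : ℂ) • taylorCoeff (M m) N =
      ∑ y ∈ Finset.HasAntidiagonal.antidiagonal (m + 1),
        ∑ a ∈ Finset.HasAntidiagonal.antidiagonal N,
          taylorCoeff (M y.1) a.1 * taylorCoeff (w y.2) a.2 -
        ∑ a ∈ Finset.HasAntidiagonal.antidiagonal N,
          taylorCoeff C a.1 * taylorCoeff (M (m + 1)) a.2 := by
    intro m N
    have h1 : taylorCoeff (fun z => z • deriv (M m) z) N = (N : ℂ) • taylorCoeff (M m) N := by
      rcases N with _ | N
      · simp [taylorCoeff_zero]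
      · rw [taylorCoeff_id_smul_succ hR (hdM m)]
        exact taylorCoeff_deriv (M m) N
    have h2 : taylorCoeff (fun z => ∑ y ∈ Finset.HasAntidiagonal.antidiagonal (m + 1),
        M y.1 z * w y.2 z) N = ∑ y ∈ Finset.HasAntidiagonal.antidiagonal (m + 1),
        taylorCoeff (fun z => M y.1 z * w y.2 z) N := by
      simp only [taylorCoeff]
      rw [iteratedDeriv_fun_sum fun y _ => ((cM y.1).mul (cw y.2)).of_le le_top,
        Finset.smul_sum]
    rw [← h1, taylorCoeff_congr (heq' m),
      taylorCoeff_sub (ContDiffAt.sum fun y _ => (cM y.1).mul (cw y.2)) (cC.mul (cM _)), h2,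
      taylorCoeff_mul cC (cM _)]
    simp only [taylorCoeff_mul (cM _) (cw _)]
  have hrec0 : ∀ N : ℕ, ∑ a ∈ Finset.HasAntidiagonal.antidiagonal N,
      taylorCoeff (M 0) a.1 * taylorCoeff (w 0) a.2 =
      ∑ a ∈ Finset.HasAntidiagonal.antidiagonal N,
      taylorCoeff C a.1 * taylorCoeff (M 0) a.2 := by
    intro N
    rw [← taylorCoeff_mul (cM 0) (cw 0), ← taylorCoeff_mul cC (cM 0)]
    exact taylorCoeff_congr (eventually_of_mem (ball_mem_nhds _ hR) hCM) N
  have hcoeff : ∀ N, 1 ≤ N → ∀ m : ℕ, taylorCoeff (M m) N ∈ upperBlocks deg (m + 2) :=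
    formal_solution_mem_upperBlocks (fun j => Finset.le_sup (f := deg) (Finset.mem_univ j))
      (M := fun m N => taylorCoeff (M m) N) (w := fun m N => taylorCoeff (w m) N)
      (C := taylorCoeff C) (by simp [taylorCoeff_zero, hM00])
      (fun m => by simp [taylorCoeff_zero, hM00]) hrec0 hrec
      (taylorCoeff_eulerMatrixCoeff_mem hdegq hW x)
      (eulerMatrixCoeff_zero_apply_ne_zero hW x)
  have h1 := mem_of_forall_taylorCoeff_mem (isClosed_upperBlocks (deg := deg) (m + 2))
    (f := fun z => M m z - if m = 0 then 1 else 0) ((hMd m).sub_const _) (fun N => by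
      rw [taylorCoeff_sub (cM m) contDiffAt_const]
      rcases N with _ | N
      · rw [taylorCoeff_zero, taylorCoeff_zero, hM00, sub_self]
        exact zero_mem _
      · have : taylorCoeff (fun _ : ℂ => (if m = 0 then 1 else 0 : Matrix (Fin n) (Fin n) ℂ))
            (N + 1) = 0 := by
          rw [taylorCoeff, iteratedDeriv_const, if_neg N.succ_ne_zero, smul_zero]
        rw [this, sub_zero]
        exact hcoeff (N + 1) (by omega) m) (z := 1) (by simp)
  simpa [hMdef] using h1

/-- The coefficients of `L₊` lie in the expected blocks. -/
theorem taylorCoeff_sub_mem (hdegq : ∀ i, 4 ≤ degq i)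
    (hW : ∀ i k j l m, ((W i k j).coeff l).coeff m ≠ 0 →
      2 * (l : ℤ) + ∑ p, degq p * m p = 2 + 2 * deg j - 2 * deg k)
    {U : Set (Fin r → ℂ)} (hUo : IsOpen U) (hUc : IsConnected U) (hU0 : (0 : Fin r → ℂ) ∈ U)
    {L Lm Lp : (Fin r → ℂ) → ℂ → Matrix (Fin n) (Fin n) ℂ}
    (hL : IsLoopSolution W (tRegion U) L) (hB : IsBirkhoff U L Lm Lp)
    (hnorm : ∀ h ∈ closedBall (0 : ℂ) 1, Lp 0 h = 1)
    {x : Fin r → ℂ} (hx : x ∈ U) (m : ℕ) :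
    taylorCoeff (Lp x) m - (if m = 0 then 1 else 0) ∈ upperBlocks deg (m + 2) := by
  obtain ⟨ε, hε, hball⟩ := Metric.isOpen_iff.1 hUo 0 hU0
  -- The factor 1/2 keeps `z • y` in the `ε`-ball for all `|z| < 2`.
  set O : Set (Fin r → ℂ) := ball 0 (ε / 2) ∩ ⋂ i, {y | y i ≠ 0} with hO
  have hOo : IsOpen O := isOpen_ball.inter (isOpen_iInter_of_finite fun i =>
    isOpen_ne_fun (continuous_apply i) continuous_const)
  have hgen : ∀ y ∈ O, taylorCoeff (Lp y) m - (if m = 0 then 1 else 0) ∈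
      upperBlocks deg (m + 2) := by
    rintro y ⟨hy1, hy2⟩
    refine taylorCoeff_sub_mem_of_generic hdegq hW hUo hL hB hnorm
      (fun i => Set.mem_iInter.1 hy2 i) (fun z hz => hball ?_) m
    rw [mem_ball_zero_iff] at hy1 hz ⊢
    rw [norm_smul]
    nlinarith [norm_nonneg z, norm_nonneg y]
  have hne : (U ∩ O).Nonempty := by
    have hn : ‖(fun _ => ((ε / 4 : ℝ) : ℂ) : Fin r → ℂ)‖ ≤ ε / 4 := by
      refine (pi_norm_le_iff_of_nonneg (by positivity)).2 fun i => ?_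
      rw [Complex.norm_real, Real.norm_of_nonneg (by positivity)]
    refine ⟨fun _ => ((ε / 4 : ℝ) : ℂ), hball ?_, ?_, Set.mem_iInter.2 fun i => ?_⟩
    · rw [mem_ball_zero_iff]
      linarith
    · rw [mem_ball_zero_iff]
      linarith
    · simpa using hε.ne'
  intro k j hkj
  refine eqOn_zero_of_line_differentiable hUo hUc.isPreconnected
    (f := fun x => (taylorCoeff (Lp x) m - (if m = 0 then 1 else 0)) k j) (fun y hy v => ?_)
    hOo hne (fun y hy => hgen y hy k j hkj) x hx
  have h1 := ((hB.plus.hasDerivAt_taylorCoeff hUo hy v m).differentiableAt).sub_const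
    (if m = 0 then 1 else 0)
  exact (entryCLM k j).differentiableAt.comp (0 : ℂ) h1

/-- The factors of the expansion of `L₊` lie in the expected blocks. -/
theorem IsExpansion.mem_upperBlocks (hdegq : ∀ i, 4 ≤ degq i)
    (hW : ∀ i k j l m, ((W i k j).coeff l).coeff m ≠ 0 →
      2 * (l : ℤ) + ∑ p, degq p * m p = 2 + 2 * deg j - 2 * deg k)
    {U : Set (Fin r → ℂ)} (hUo : IsOpen U) (hUc : IsConnected U) (hU0 : (0 : Fin r → ℂ) ∈ U)
    {L Lm Lp : (Fin r → ℂ) → ℂ → Matrix (Fin n) (Fin n) ℂ}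
    (hL : IsLoopSolution W (tRegion U) L) (hB : IsBirkhoff U L Lm Lp)
    (hnorm : ∀ h ∈ closedBall (0 : ℂ) 1, Lp 0 h = 1)
    {Q : ℕ → (Fin r → ℂ) → Matrix (Fin n) (Fin n) ℂ} (hQ : IsExpansion U Lp Q)
    {x : Fin r → ℂ} (hx : x ∈ U) :
    Q 0 x - 1 ∈ upperBlocks deg 2 ∧
      ∀ i : ℕ, 1 ≤ i → Q 0 x * Q i x ∈ upperBlocks deg (i + 2) := by
  have hmem := taylorCoeff_sub_mem (deg := deg) hdegq hW hUo hUc hU0 hL hB hnorm hx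
  have hcoeff : ∀ i, taylorCoeff (Lp x) i = Q 0 x * if i = 0 then 1 else Q i x := fun i =>
    taylorCoeff_eq_of_hasSum (c := fun i => Q 0 x * if i = 0 then 1 else Q i x) one_pos (hQ x hx) i
  refine ⟨?_, fun i hi => ?_⟩
  · simpa [hcoeff] using hmem 0
  · have hi0 : i ≠ 0 := by omega
    have h1 := hmem i
    rwa [hcoeff i, if_neg hi0, if_neg hi0, sub_zero] at h1

end Grading

theorem block_eq_zero {n : ℕ} {deg : Fin n → ℕ} {c : ℤ} {A : Matrix (Fin n) (Fin n) ℂ}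
    (hA : A ∈ upperBlocks deg c) {α β : ℕ} (h : (β : ℤ) < α + c) : block deg A α β = 0 := by
  ext ⟨k, hk⟩ ⟨j, hj⟩
  exact hA k j (by rw [hk, hj]; exact h)

end QDM

/-! ### Assembly of the proposition. -/

open QDM in
theorem proposition4p1
    {r u s : ℕ} {K : Type*} [CommRing K] [Algebra ℂ K] [FunctionAlgebra r K]
    -- degrees of `q₁, …, q_r`
    (degq : Fin r → ℤ) (hdegq : ∀ i, 4 ≤ degq i)
    -- homogeneous operators defining the D-module `M^h`
    (D : Fin u → QDM.Dh r K) (d : Fin u → ℤ)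
    (hD : ∀ l, D l ∈ QDM.homogeneousOps degq (d l))
    -- `M^h` is free over `K[h]` with a basis of monomials `P_j` in `h∂₁, …, h∂_r`
    (b : Module.Basis (Fin (s + 1)) (Polynomial K) (QDM.Mh D))
    (a : Fin (s + 1) → Fin r → ℕ)
    (hb : ∀ j, b j = QDM.Mh.mk D (QDM.mono r K (a j)))
    -- the matrices `h Ω^h_i` are polynomial in `q` (and `h`)
    (W : Fin r → Matrix (Fin (s + 1)) (Fin (s + 1)) (Polynomial (MvPolynomial (Fin r) ℂ)))
    (hW : ∀ i, QDM.hOmega b i = (W i).map (Polynomial.map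
      ((FunctionAlgebra.ofPoly (r := r) (K := K) : MvPolynomial (Fin r) ℂ →ₐ[ℂ] K) :
        MvPolynomial (Fin r) ℂ →+* K)))
    -- `Ω^h = L⁻¹ dL`, with Birkhoff factorization `L = L₋ L₊` such that `L₊ = I` at `q = 0`
    (U : Set (Fin r → ℂ)) (hUo : IsOpen U) (hUc : IsConnected U) (hU0 : (0 : Fin r → ℂ) ∈ U)
    (L Lm Lp : (Fin r → ℂ) → ℂ → Matrix (Fin (s + 1)) (Fin (s + 1)) ℂ)
    (hL : QDM.IsLoopSolution W (QDM.tRegion U) L)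
    (hB : QDM.IsBirkhoff U L Lm Lp)
    (hnorm : ∀ h ∈ Metric.closedBall (0 : ℂ) 1, Lp 0 h = 1)
    (Q : ℕ → (Fin r → ℂ) → Matrix (Fin (s + 1)) (Fin (s + 1)) ℂ)
    (hQ : QDM.IsExpansion U Lp Q) :
    (∃ X : (Fin r → ℂ) → Matrix (Fin (s + 1)) (Fin (s + 1)) ℂ, ∀ x ∈ U,
      Q 0 x = NormedSpace.exp (X x) ∧
      ∀ α β : ℕ, (β : ℤ) - 1 ≤ α → QDM.block (fun j => ∑ l, a j l) (X x) α β = 0) ∧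
    (∀ i : ℕ, 1 ≤ i → ∀ x ∈ U, ∀ α β : ℕ, (β : ℤ) - i - 1 ≤ α →
      QDM.block (fun j => ∑ l, a j l) (Q i x) α β = 0) ∧
    (∃ N : ℕ, (∀ i, N < i → ∀ x ∈ U, Q i x = 0) ∧
      ∀ x ∈ U, ∀ h ∈ Metric.closedBall (0 : ℂ) 1,
        Lp x h = Q 0 x * (1 + ∑ i ∈ Finset.Icc 1 N, h ^ i • Q i x)) := by
  set deg : Fin (s + 1) → ℕ := fun j => ∑ l, a j l with hdeg
  have hdegW := degree_eq_of_coeff_ne_zero hD b a hb W hW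
  have hmem := fun (x : Fin r → ℂ) (hx : x ∈ U) =>
    hQ.mem_upperBlocks (deg := deg) hdegq hdegW hUo hUc hU0 hL hB hnorm hx
  set N := Finset.univ.sup deg with hN
  have hNdeg : ∀ j, deg j ≤ N := fun j => Finset.le_sup (f := deg) (Finset.mem_univ j)
  have hexp : ∀ x ∈ U, ∃ X ∈ upperBlocks deg 2, Q 0 x = NormedSpace.exp X := by
    intro x hx
    obtain ⟨X, hX, hXexp, -⟩ := exists_exp_eq_one_add hNdeg (by norm_num) (hmem x hx).1
    exact ⟨X, hX, by rw [hXexp, add_sub_cancel]⟩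
  choose! X hX hQX using hexp
  have hQi : ∀ i : ℕ, 1 ≤ i → ∀ x ∈ U, Q i x ∈ upperBlocks deg (i + 2) := by
    intro i hi x hx
    have h1 := (hmem x hx).2 i hi
    rw [hQX x hx] at h1
    -- The inverse `exp(-X)` of `Q₀` lies in filtration step 0, so removing `Q₀` costs nothing.
    have h2 := mul_mem_upperBlocks (exp_mem_upperBlocks (c := 2) (by norm_num) (neg_mem (hX x hx)))
      h1
    rwa [← mul_assoc, ← Matrix.exp_add_of_commute _ _ ((Commute.refl (X x)).neg_left),
      neg_add_cancel, NormedSpace.exp_zero, one_mul, zero_add] at h2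
  have hQ0 : ∀ i, N < i → ∀ x ∈ U, Q i x = 0 := fun i hi x hx =>
    eq_zero_of_mem_upperBlocks hNdeg (by omega) (hQi i (by omega) x hx)
  refine ⟨⟨X, fun x hx => ⟨hQX x hx, fun α β h => block_eq_zero (hX x hx) (by omega)⟩⟩,
    fun i hi x hx α β h => block_eq_zero (hQi i hi x hx) (by omega), N, hQ0, fun x hx => ?_⟩
  have hopen : Set.EqOn (Lp x)
      (fun h => Q 0 x * (1 + ∑ i ∈ Finset.Icc 1 N, h ^ i • Q i x)) (Metric.ball 0 1) := by
    intro h hh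
    refine (hQ x hx h hh).unique ?_
    have h1 := hasSum_sum_of_ne_finset_zero (L := SummationFilter.unconditional ℕ)
      (f := fun i : ℕ => h ^ i • (Q 0 x * if i = 0 then 1 else Q i x))
      (s := Finset.range (N + 1)) (fun i hi => by
        have hi' : N < i := by simpa using hi
        rw [if_neg (by omega), hQ0 i hi' x hx, mul_zero, smul_zero])
    convert h1 using 1
    rw [Finset.range_eq_Ico, Finset.sum_eq_sum_Ico_succ_bot N.succ_pos]
    simp only [mul_add, Finset.mul_sum, pow_zero, one_smul, if_true, mul_one, zero_add]
    congr 1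
    refine Finset.sum_congr (by ext i; simp) fun i hi => ?_
    rw [if_neg (by have := (Finset.mem_Icc.1 hi).1; omega), mul_smul_comm]
  -- The expansion is given only for `|h| < 1`; continuity of both sides reaches the boundary
  -- circle.
  refine fun h hh => hopen.of_subset_closure ?_ ?_ Metric.ball_subset_closedBall ?_ hh
  · exact hB.plus.continuousOn.comp (f := fun z => (x, z)) (by fun_prop) fun z hz => ⟨hx, hz⟩
  · fun_prop
  · rw [closure_ball _ one_ne_zero]
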